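/- Let $\beta\in[0,1]$ be irrational and let $\lambda_1,\lambda_2>0$ be real numbers. Put $$a(n)=(\lambda_1-\lambda_2)\bigl(\lfloor (n+1)\beta\rfloor-\lfloor n\beta\rfloor\bigr)+\lambda_2,\qquad n\in\mathbb Z,$$ and let $H$ be the bounded self-adjoint off-diagonal Sturmian Jacobi operator on $\ell^2(\mathbb Z)$ given by $$(H\psi)(n)=a(n)\,\psi(n+1)+a(n-1)\,\psi(n-1).$$ Write $\beta=[a_1,a_2,\dots]=\cfrac{1}{a_1+\cfrac{1}{a_2+\cdots}}$ for the continued fraction expansion of $\beta$, and let $q_n$ be the denominators of its convergents: $q_{-1}=0$, $q_0=1$, $q_{k+1}=a_{k+1}q_k+q_{k-1}$ for $k\ge 0$. For $E\in\mathbb R$ let $$T_n(E)=\frac1{a(n)}\begin{pmatrix}E&-1\\ a(n)^2&0\end{pmatrix},\qquad M_n(E)=T_{q_n}(E)\,T_{q_n-1}(E)\cdots T_1(E),\qquad x_n(E)=\operatorname{Tr}M_n(E)\quad(n\ge 0),$$ and let $B_\infty=\{E\in\mathbb R:\ \text{the sequence }(x_n(E))_{n\ge0}\text{ is bounded}\}$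 be the pseudo-spectrum. Then $$\sigma(H)=B_\infty .$$ -/

import Mathlib

noncomputable section

namespace SturmianJacobi

/-! ## Jacobi operators on the two-sided square-summable sequences -/

/-- The Hilbert space of square-summable complex sequences indexed by the integers. -/
abbrev EllTwo : Type := lp (fun _ : ℤ => ℂ) 2

theorem memlp_weighted_shift {c : ℤ → ℝ} {C : ℝ} (hc : ∀ n, |c n| ≤ C) (k : ℤ) (ψ : EllTwo) :
    Memℓp (fun n : ℤ => (c n : ℂ) * ψ (n + k)) 2 := by
  have h2 : (0 : ℝ) < (2 : ENNReal).toReal := by norm_num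
  have hs : Summable fun n : ℤ => ‖ψ (n + k)‖ ^ (2 : ENNReal).toReal :=
    ((lp.memℓp ψ).summable h2).comp_injective (add_left_injective k)
  have hC : 0 ≤ C := (abs_nonneg _).trans (hc 0)
  refine memℓp_gen (Summable.of_nonneg_of_le (fun n => by positivity) (fun n => ?_)
    (hs.mul_left (C ^ (2 : ENNReal).toReal)))
  rw [← Real.mul_rpow hC (norm_nonneg _), norm_mul, Complex.norm_real, Real.norm_eq_abs]
  exact Real.rpow_le_rpow (by positivity)
    (mul_le_mul_of_nonneg_right (hc n) (norm_nonneg _)) h2.le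

/-- The bounded operator `(W ψ)(n) = c(n) ψ(n + k)`, for a bounded real sequence `c`. -/
def weightedShift (c : ℤ → ℝ) (hc : ∃ C, ∀ n, |c n| ≤ C) (k : ℤ) : EllTwo →L[ℂ] EllTwo :=
  LinearMap.mkContinuousOfExistsBound
    { toFun := fun ψ => ⟨fun n => (c n : ℂ) * ψ (n + k), memlp_weighted_shift hc.choose_spec k ψ⟩
      map_add' := fun φ ψ => by
        apply lp.ext
        funext n
        exact mul_add (c n : ℂ) (φ (n + k)) (ψ (n + k))
      map_smul' := fun z ψ => by
        apply lp.ext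
        funext n
        exact mul_left_comm (c n : ℂ) z (ψ (n + k)) }
    (by
      obtain ⟨C, hC⟩ := hc
      have h2 : (0 : ℝ) < (2 : ENNReal).toReal := by norm_num
      have hC0 : 0 ≤ C := (abs_nonneg _).trans (hC 0)
      refine ⟨C, fun ψ => lp.norm_le_of_tsum_le h2 (by positivity) ?_⟩
      have hs : Summable fun n : ℤ => ‖ψ (n + k)‖ ^ (2 : ENNReal).toReal :=
        ((lp.memℓp ψ).summable h2).comp_injective (add_left_injective k)
      have hle : ∀ n : ℤ, ‖(c n : ℂ) * ψ (n + k)‖ ^ (2 : ENNReal).toReal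
          ≤ C ^ (2 : ENNReal).toReal * ‖ψ (n + k)‖ ^ (2 : ENNReal).toReal := fun n => by
        rw [← Real.mul_rpow hC0 (norm_nonneg _), norm_mul, Complex.norm_real, Real.norm_eq_abs]
        exact Real.rpow_le_rpow (by positivity)
          (mul_le_mul_of_nonneg_right (hC n) (norm_nonneg _)) h2.le
      have hsum : ∑' n : ℤ, ‖ψ (n + k)‖ ^ (2 : ENNReal).toReal = ‖ψ‖ ^ (2 : ENNReal).toReal := by
        rw [lp.norm_rpow_eq_tsum h2 ψ]
        exact (Equiv.addRight k).tsum_eq fun n : ℤ => ‖ψ n‖ ^ (2 : ENNReal).toReal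
      calc ∑' n : ℤ, ‖(c n : ℂ) * ψ (n + k)‖ ^ (2 : ENNReal).toReal
          ≤ ∑' n : ℤ, C ^ (2 : ENNReal).toReal * ‖ψ (n + k)‖ ^ (2 : ENNReal).toReal :=
            Summable.tsum_le_tsum hle
              ((memlp_weighted_shift hC k ψ).summable h2) (hs.mul_left _)
        _ = (C * ‖ψ‖) ^ (2 : ENNReal).toReal := by
            rw [tsum_mul_left, hsum, Real.mul_rpow hC0 (norm_nonneg _)])

theorem weightedShift_apply (c : ℤ → ℝ) (hc : ∃ C, ∀ n, |c n| ≤ C) (k : ℤ) (ψ : EllTwo) (n : ℤ) :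
    weightedShift c hc k ψ n = (c n : ℂ) * ψ (n + k) := rfl

/-- The Jacobi operator with bounded off-diagonal sequence `a` and bounded diagonal sequence `b`;
its action is spelled out in `jacobiOperator_apply`. -/
def jacobiOperator (a b : ℤ → ℝ) (ha : ∃ C, ∀ n, |a n| ≤ C) (hb : ∃ C, ∀ n, |b n| ≤ C) :
    EllTwo →L[ℂ] EllTwo :=
  weightedShift a ha 1
    + weightedShift (fun n => a (n - 1)) (ha.imp fun _ h n => h (n - 1)) (-1)
    + weightedShift b hb 0

theorem jacobiOperator_apply (a b : ℤ → ℝ) (ha : ∃ C, ∀ n, |a n| ≤ C)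
    (hb : ∃ C, ∀ n, |b n| ≤ C) (ψ : EllTwo) (n : ℤ) :
    jacobiOperator a b ha hb ψ n
      = (a n : ℂ) * ψ (n + 1) + (a (n - 1) : ℂ) * ψ (n - 1) + (b n : ℂ) * ψ n := by
  have h : jacobiOperator a b ha hb ψ n
      = (a n : ℂ) * ψ (n + 1) + (a (n - 1) : ℂ) * ψ (n + -1) + (b n : ℂ) * ψ (n + 0) := rfl
  rw [h, add_zero, ← sub_eq_add_neg]

/-! ## The off-diagonal Sturmian operator -/

/-- The Sturmian sequence `⌊(n+1)β⌋ - ⌊nβ⌋` of slope `β`. -/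
def sturmian (β : ℝ) (n : ℤ) : ℤ := ⌊((n : ℝ) + 1) * β⌋ - ⌊(n : ℝ) * β⌋

/-- The hopping sequence `a(n) = (λ₁ - λ₂)(⌊(n+1)β⌋ - ⌊nβ⌋) + λ₂`. -/
def hopping (β lam₁ lam₂ : ℝ) (n : ℤ) : ℝ := (lam₁ - lam₂) * (sturmian β n : ℝ) + lam₂

theorem abs_sturmian_le (β : ℝ) (n : ℤ) : |(sturmian β n : ℝ)| ≤ |β| + 1 := by
  have h1 := Int.floor_le (((n : ℝ) + 1) * β)
  have h2 := Int.lt_floor_add_one (((n : ℝ) + 1) * β)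
  have h3 := Int.floor_le ((n : ℝ) * β)
  have h4 := Int.lt_floor_add_one ((n : ℝ) * β)
  have h5 := le_abs_self β
  have h6 := neg_abs_le β
  have h7 : ((n : ℝ) + 1) * β = (n : ℝ) * β + β := by ring
  rw [h7] at h1 h2
  rw [sturmian, h7, Int.cast_sub, abs_le]
  constructor <;> linarith

theorem hopping_bounded (β lam₁ lam₂ : ℝ) : ∃ C, ∀ n, |hopping β lam₁ lam₂ n| ≤ C := by
  refine ⟨|lam₁ - lam₂| * (|β| + 1) + |lam₂|, fun n => ?_⟩
  refine (abs_add_le _ _).trans (add_le_add ?_ le_rfl)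
  rw [abs_mul]
  exact mul_le_mul_of_nonneg_left (abs_sturmian_le β n) (abs_nonneg _)

/-- The off-diagonal Sturmian operator: the Jacobi operator with off-diagonal sequence
`hopping β lam₁ lam₂` and zero diagonal. -/
def offDiagonalOperator (β lam₁ lam₂ : ℝ) : EllTwo →L[ℂ] EllTwo :=
  jacobiOperator (hopping β lam₁ lam₂) (fun _ => 0) (hopping_bounded β lam₁ lam₂)
    ⟨0, fun _ => by simp⟩

/-! ## Continued fraction denominators, transfer matrices and the pseudo-spectrum -/

/-- The partial quotients of `β = 1 / (a₁ + 1 / (a₂ + ⋯))` for an irrational `β` in `(0, 1)`: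
`partialQuotient β k` is `a_{k+1}`, obtained by iterating the Gauss map `x ↦ fract (1 / x)`. -/
def partialQuotient (β : ℝ) (k : ℕ) : ℕ := ⌊((fun x : ℝ => Int.fract x⁻¹)^[k] β)⁻¹⌋₊

/-- The denominators of the convergents of `β`:
`q₀ = 1`, `q₁ = a₁` and `q_{k+2} = a_{k+2} q_{k+1} + q_k`. -/
def convergentDen (β : ℝ) : ℕ → ℕ
  | 0 => 1
  | 1 => partialQuotient β 0
  | k + 2 => partialQuotient β (k + 1) * convergentDen β (k + 1) + convergentDen β k

/-- The one-step transfer matrix of the off-diagonal model, for a hopping value `a`. -/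
def stepMatrix (a E : ℝ) : Matrix (Fin 2) (Fin 2) ℝ := (1 / a) • !![E, -1; a ^ 2, 0]

/-- The product `F_n(E) = T_n(E) ⋯ T_1(E)` of one-step transfer matrices. -/
def transferProduct (a : ℤ → ℝ) (E : ℝ) : ℕ → Matrix (Fin 2) (Fin 2) ℝ
  | 0 => 1
  | n + 1 => stepMatrix (a ((n : ℤ) + 1)) E * transferProduct a E n

/-- The transfer matrix `M_n(E) = F_{q_n}(E)`. -/
def transferMatrix (β lam₁ lam₂ E : ℝ) (n : ℕ) : Matrix (Fin 2) (Fin 2) ℝ :=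
  transferProduct (hopping β lam₁ lam₂) E (convergentDen β n)

/-- The trace `x_n(E) = Tr M_n(E)`. -/
def traceSeq (β lam₁ lam₂ E : ℝ) (n : ℕ) : ℝ := (transferMatrix β lam₁ lam₂ E n).trace

/-- The pseudo-spectrum: the real energies at which the sequence `x_n(E)` is bounded. -/
def pseudoSpectrum (β lam₁ lam₂ : ℝ) : Set ℝ :=
  {E : ℝ | ∃ C : ℝ, ∀ n : ℕ, |traceSeq β lam₁ lam₂ E n| ≤ C}

end SturmianJacobi

end

/-!
The matrices `M_n = M_n(E)` satisfy a recursion `M_{n+2} = M_n * M_{n+1} ^ a` with `a` a partial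
quotient, so their traces follow a trace map that preserves the Fricke–Vogt polynomial. Hence there
is a dichotomy. Either the orbit escapes, which is an open condition on `E` and forces
`|x_n| → ∞` locally uniformly, or the traces are bounded and `|x_n| ≤ 2` for infinitely many `n`.

If `|x_n| ≤ 2` then `M_n` has an eigenvalue of modulus one. The best approximation property of `q_n`
makes the hopping sequence repeat its first block of length `q_n`, so an eigenvector of `M_n`
spreads to a solution whose modulus is periodic over two blocks. Cut off by a tent, it is an
approximate eigenvector of `H` with error `O(1 / q_n)`. Infinitely many such `n` put `E` into the
spectrum.

Conversely, an energy of the spectrum has approximate eigenvectors of finite support. For `n` even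
the hopping sequence is `q_n`-periodic across the origin, so they can be wrapped around the cycle of
length `q_n`, whose Jacobi matrix thus has an eigenvalue `E'` close to `E`. There `x_n(E') = 2`,
which is impossible for large `n` near an escaping energy.
-/

noncomputable section

namespace SturmianJacobi

/-! ### Continued fractions and floors -/

section Convergents

variable {β : ℝ}

/-- The `k`-th iterate of the Gauss map `x ↦ fract (1 / x)` at `β`, that is, the tail
`[a_{k+1}, a_{k+2}, …]` of the continued fraction of `β`. -/
def gaussIterate (β : ℝ) (k : ℕ) : ℝ := (fun x : ℝ => Int.fract x⁻¹)^[k] β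

/-- The numerators `p_n` of the convergents of `β ∈ (0, 1)`, the companions of `convergentDen`. -/
def convergentNum (β : ℝ) : ℕ → ℕ
  | 0 => 0
  | 1 => 1
  | k + 2 => partialQuotient β (k + 1) * convergentNum β (k + 1) + convergentNum β k

/-- The signed approximation error `q_n β - p_n` of the `n`-th convergent. -/
def convergentError (β : ℝ) (n : ℕ) : ℝ := convergentDen β n * β - convergentNum β n

theorem gaussIterate_zero (β : ℝ) : gaussIterate β 0 = β := rfl

theorem gaussIterate_succ (β : ℝ) (k : ℕ) :
    gaussIterate β (k + 1) = Int.fract (gaussIterate β k)⁻¹ :=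
  Function.iterate_succ_apply' _ _ _

theorem convergentDen_zero (β : ℝ) : convergentDen β 0 = 1 := rfl

theorem convergentDen_add_two (β : ℝ) (k : ℕ) : convergentDen β (k + 2)
    = partialQuotient β (k + 1) * convergentDen β (k + 1) + convergentDen β k := rfl

theorem convergentNum_add_two (β : ℝ) (k : ℕ) : convergentNum β (k + 2)
    = partialQuotient β (k + 1) * convergentNum β (k + 1) + convergentNum β k := rfl

theorem convergentError_add_two (β : ℝ) (k : ℕ) : convergentError β (k + 2)
    = partialQuotient β (k + 1) * convergentError β (k + 1) + convergentError β k := by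
  simp only [convergentError, convergentDen_add_two, convergentNum_add_two]
  push_cast
  ring

theorem irrational_gaussIterate (hirr : Irrational β) (k : ℕ) :
    Irrational (gaussIterate β k) := by
  induction k with
  | zero => exact hirr
  | succ k ih =>
    rw [gaussIterate_succ, Int.fract]
    exact (irrational_inv_iff.mpr ih).sub_intCast _

theorem gaussIterate_mem_Ioo (hβ : β ∈ Set.Icc (0 : ℝ) 1) (hirr : Irrational β) (k : ℕ) :
    gaussIterate β k ∈ Set.Ioo (0 : ℝ) 1 := by
  have hne := (irrational_gaussIterate hirr k).ne_zero.symm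
  cases k with
  | zero => exact ⟨hβ.1.lt_of_ne hne, hβ.2.lt_of_ne hirr.ne_one⟩
  | succ k =>
    rw [gaussIterate_succ] at hne ⊢
    exact ⟨(Int.fract_nonneg _).lt_of_ne hne, Int.fract_lt_one _⟩

theorem natCast_partialQuotient (hβ : β ∈ Set.Icc (0 : ℝ) 1) (hirr : Irrational β) (k : ℕ) :
    (partialQuotient β k : ℝ) = (gaussIterate β k)⁻¹ - gaussIterate β (k + 1) := by
  rw [gaussIterate_succ, Int.self_sub_fract]
  exact natCast_floor_eq_intCast_floor (inv_pos.mpr (gaussIterate_mem_Ioo hβ hirr k).1).le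

theorem partialQuotient_pos (hβ : β ∈ Set.Icc (0 : ℝ) 1) (hirr : Irrational β) (k : ℕ) :
    0 < partialQuotient β k := by
  have h := gaussIterate_mem_Ioo hβ hirr k
  exact Nat.floor_pos.mpr ((one_lt_inv₀ h.1).mpr h.2).le

theorem convergentDen_pos (hβ : β ∈ Set.Icc (0 : ℝ) 1) (hirr : Irrational β) (n : ℕ) :
    0 < convergentDen β n := by
  induction n using Nat.twoStepInduction with
  | zero => exact one_pos
  | one => exact partialQuotient_pos hβ hirr 0
  | more n ih _ => exact Nat.add_pos_right _ ih

theorem convergentDen_add_le (hβ : β ∈ Set.Icc (0 : ℝ) 1) (hirr : Irrational β) (n : ℕ) :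
    convergentDen β (n + 1) + convergentDen β n ≤ convergentDen β (n + 2) :=
  Nat.add_le_add_right (Nat.le_mul_of_pos_left _ (partialQuotient_pos hβ hirr (n + 1))) _

theorem convergentDen_le_succ (hβ : β ∈ Set.Icc (0 : ℝ) 1) (hirr : Irrational β) (n : ℕ) :
    convergentDen β n ≤ convergentDen β (n + 1) := by
  cases n with
  | zero => exact convergentDen_pos hβ hirr 1
  | succ n => exact (Nat.le_add_right _ _).trans (convergentDen_add_le hβ hirr n)

theorem one_lt_convergentDen_add_two (hβ : β ∈ Set.Icc (0 : ℝ) 1) (hirr : Irrational β) (n : ℕ) :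
    1 < convergentDen β (n + 2) :=
  (Nat.add_le_add (convergentDen_pos hβ hirr (n + 1)) (convergentDen_pos hβ hirr n)).trans
    (convergentDen_add_le hβ hirr n)

theorem le_convergentDen (hβ : β ∈ Set.Icc (0 : ℝ) 1) (hirr : Irrational β) (n : ℕ) :
    n ≤ convergentDen β n := by
  induction n using Nat.twoStepInduction with
  | zero => exact Nat.zero_le _
  | one => exact partialQuotient_pos hβ hirr 0
  | more n _ ih =>
    exact (Nat.add_le_add ih (convergentDen_pos hβ hirr n)).trans (convergentDen_add_le hβ hirr n)

theorem convergentError_succ (hβ : β ∈ Set.Icc (0 : ℝ) 1) (hirr : Irrational β) (n : ℕ) :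
    convergentError β (n + 1) = -gaussIterate β (n + 1) * convergentError β n := by
  induction n with
  | zero =>
    have hne := hirr.ne_zero
    have hq := natCast_partialQuotient hβ hirr 0
    rw [gaussIterate_zero] at hq
    simp only [convergentError, convergentDen, convergentNum, hq]
    push_cast
    field_simp
    ring
  | succ n ih =>
    have hne := (irrational_gaussIterate hirr (n + 1)).ne_zero
    rw [convergentError_add_two, natCast_partialQuotient hβ hirr, ih]
    field_simp
    ring

theorem neg_one_pow_mul_convergentError_mem_Ioo (hβ : β ∈ Set.Icc (0 : ℝ) 1)
    (hirr : Irrational β) (n : ℕ) : (-1) ^ n * convergentError β n ∈ Set.Ioo (0 : ℝ) 1 := by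
  induction n with
  | zero =>
    simpa [convergentError, convergentDen, convergentNum, gaussIterate_zero]
      using gaussIterate_mem_Ioo hβ hirr 0
  | succ n ih =>
    have h : (-1) ^ (n + 1) * convergentError β (n + 1)
        = gaussIterate β (n + 1) * ((-1) ^ n * convergentError β n) := by
      rw [convergentError_succ hβ hirr n]
      ring
    have hg := gaussIterate_mem_Ioo hβ hirr (n + 1)
    rw [h]
    exact ⟨mul_pos hg.1 ih.1, mul_lt_one_of_nonneg_of_lt_one_left hg.1.le hg.2 ih.2.le⟩

theorem convergentNum_mul_convergentDen_sub (β : ℝ) (n : ℕ) :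
    (convergentNum β (n + 1) : ℤ) * convergentDen β n - convergentNum β n * convergentDen β (n + 1)
      = (-1) ^ n := by
  induction n with
  | zero => simp [convergentNum, convergentDen]
  | succ n ih =>
    rw [convergentDen_add_two, convergentNum_add_two, pow_succ, ← ih]
    push_cast
    ring

theorem exists_eq_mul_convergent_add (β : ℝ) (n : ℕ) (k m : ℤ) :
    ∃ x y : ℤ, k = x * convergentDen β n + y * convergentDen β (n + 1) ∧
      m = x * convergentNum β n + y * convergentNum β (n + 1) := by
  have hdet := convergentNum_mul_convergentDen_sub β n
  have hsq : ((-1 : ℤ) ^ n) * (-1) ^ n = 1 := by rw [← mul_pow]; norm_num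
  refine ⟨(-1) ^ n * (convergentNum β (n + 1) * k - convergentDen β (n + 1) * m),
    (-1) ^ n * (convergentDen β n * m - convergentNum β n * k), ?_, ?_⟩
  · linear_combination (-k) * hsq - (-1) ^ n * k * hdet
  · linear_combination (-m) * hsq - (-1) ^ n * m * hdet

theorem ne_zero_and_mul_nonpos_of_abs_lt {q q' x y : ℤ} (hq : 0 < q)
    (hne : x * q + y * q' ≠ 0) (hlt : |x * q + y * q'| < q') : x ≠ 0 ∧ x * y ≤ 0 := by
  rw [abs_lt] at hlt
  constructor
  · rintro rfl
    rcases lt_trichotomy y 0 with h | rfl | h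
    · nlinarith
    · simp at hne
    · nlinarith
  · by_contra! h
    rcases pos_and_pos_or_neg_and_neg_of_mul_pos h with ⟨hx, hy⟩ | ⟨hx, hy⟩ <;> nlinarith

theorem abs_convergentError_le (hβ : β ∈ Set.Icc (0 : ℝ) 1) (hirr : Irrational β) (n : ℕ)
    {k : ℤ} (hk : k ≠ 0) (hkq : |k| < convergentDen β (n + 1)) (m : ℤ) :
    |convergentError β n| ≤ |k * β - m| := by
  obtain ⟨x, y, rfl, rfl⟩ := exists_eq_mul_convergent_add β n k m
  obtain ⟨hx, hxy⟩ := ne_zero_and_mul_nonpos_of_abs_lt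
    (Int.natCast_pos.mpr (convergentDen_pos hβ hirr n)) hk hkq
  have hfactor : ((x * convergentDen β n + y * convergentDen β (n + 1) : ℤ) : ℝ) * β
      - (x * convergentNum β n + y * convergentNum β (n + 1) : ℤ)
      = (x - y * gaussIterate β (n + 1)) * convergentError β n := by
    have hsucc := convergentError_succ hβ hirr n
    simp only [convergentError] at hsucc ⊢
    push_cast
    linear_combination (y : ℝ) * hsucc
  have hxR : (1 : ℝ) ≤ (x : ℝ) ^ 2 := by
    exact_mod_cast (one_le_sq_iff_one_le_abs x).mpr (Int.one_le_abs hx)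
  have hxyR : (x : ℝ) * y ≤ 0 := by exact_mod_cast hxy
  have hcoeff : 1 ≤ |(x : ℝ) - y * gaussIterate β (n + 1)| := by
    rw [← one_le_sq_iff_one_le_abs]
    nlinarith [mul_nonpos_of_nonneg_of_nonpos (gaussIterate_mem_Ioo hβ hirr (n + 1)).1.le hxyR,
      sq_nonneg ((y : ℝ) * gaussIterate β (n + 1))]
  rw [hfactor, abs_mul]
  exact le_mul_of_one_le_left (abs_nonneg _) hcoeff

theorem floor_add_convergentDen_mul (hβ : β ∈ Set.Icc (0 : ℝ) 1) (hirr : Irrational β) (n : ℕ)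
    {k : ℤ} (hk : k ≠ 0) (hkq : |k| < convergentDen β (n + 1)) (hkn : k + convergentDen β n ≠ 0) :
    ⌊((k + convergentDen β n : ℤ) : ℝ) * β⌋ = ⌊(k : ℝ) * β⌋ + convergentNum β n := by
  have hsum : ((k + convergentDen β n : ℤ) : ℝ) * β
      = k * β + convergentNum β n + convergentError β n := by
    rw [convergentError]
    push_cast
    ring
  have hne : ((k + convergentDen β n : ℤ) : ℝ) * β
      ≠ ((⌊(k : ℝ) * β⌋ + convergentNum β n + 1 : ℤ) : ℝ) :=
    (hirr.intCast_mul hkn).ne_int _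
  have hdist_floor : |convergentError β n| ≤ k * β - ⌊(k : ℝ) * β⌋ := by
    simpa only [Int.self_sub_floor, Int.abs_fract] using
      abs_convergentError_le hβ hirr n hk hkq ⌊(k : ℝ) * β⌋
  have hdist_succ : |convergentError β n| ≤ ⌊(k : ℝ) * β⌋ + 1 - k * β := by
    have h := abs_convergentError_le hβ hirr n hk hkq (⌊(k : ℝ) * β⌋ + 1)
    rwa [abs_sub_comm, Int.cast_add, Int.cast_one,
      abs_of_pos (sub_pos.mpr (Int.lt_floor_add_one _))] at h
  have hlower := neg_abs_le (convergentError β n)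
  have hupper := le_abs_self (convergentError β n)
  rw [Int.floor_eq_iff]
  push_cast at hsum hne ⊢
  exact ⟨by linarith, lt_of_le_of_ne (by linarith) hne⟩

theorem floor_convergentDen_mul_of_even (hβ : β ∈ Set.Icc (0 : ℝ) 1) (hirr : Irrational β) {n : ℕ}
    (hn : Even n) : ⌊(convergentDen β n : ℝ) * β⌋ = convergentNum β n := by
  have h := neg_one_pow_mul_convergentError_mem_Ioo hβ hirr n
  rw [hn.neg_one_pow, one_mul, convergentError, Set.mem_Ioo] at h
  rw [Int.floor_eq_iff, Int.cast_natCast]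
  constructor <;> linarith

theorem floor_convergentDen_mul_of_odd (hβ : β ∈ Set.Icc (0 : ℝ) 1) (hirr : Irrational β) {n : ℕ}
    (hn : Odd n) : ⌊(convergentDen β n : ℝ) * β⌋ = (convergentNum β n : ℤ) - 1 := by
  have h := neg_one_pow_mul_convergentError_mem_Ioo hβ hirr n
  rw [hn.neg_one_pow, convergentError, Set.mem_Ioo] at h
  rw [Int.floor_eq_iff]
  push_cast
  constructor <;> linarith

theorem floor_convergentDen_add_one_mul (hβ : β ∈ Set.Icc (0 : ℝ) 1) (hirr : Irrational β)
    (n : ℕ) : ⌊((convergentDen β (n + 1) : ℝ) + 1) * β⌋ = convergentNum β (n + 1) := by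
  have hfloor : ⌊β⌋ = 0 :=
    Int.floor_eq_zero_iff.mpr (Set.Ioo_subset_Ico_self (gaussIterate_mem_Ioo hβ hirr 0))
  have h := floor_add_convergentDen_mul hβ hirr (n + 1) (k := 1) one_ne_zero
    (by exact_mod_cast one_lt_convergentDen_add_two hβ hirr n) (by omega)
  push_cast at h
  rwa [one_mul, hfloor, zero_add, add_comm (1 : ℝ)] at h

end Convergents

/-! ### Repetitions in the Sturmian sequence -/

section Sturmian

variable {β : ℝ}

theorem sturmian_add_eq_of_floor {k m p : ℤ}
    (hk : ⌊((k + m : ℤ) : ℝ) * β⌋ = ⌊(k : ℝ) * β⌋ + p)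
    (hk' : ⌊((k + 1 + m : ℤ) : ℝ) * β⌋ = ⌊((k + 1 : ℤ) : ℝ) * β⌋ + p) :
    sturmian β (k + m) = sturmian β k := by
  have hshift : ((k + m : ℤ) : ℝ) + 1 = ((k + 1 + m : ℤ) : ℝ) := by push_cast; ring
  rw [sturmian, sturmian, hshift, hk, hk']
  push_cast
  ring

theorem sturmian_add_convergentDen (hβ : β ∈ Set.Icc (0 : ℝ) 1) (hirr : Irrational β) (n : ℕ)
    {k : ℤ} (hk : 1 ≤ k) (hkq : k + 2 ≤ convergentDen β (n + 1)) :
    sturmian β (k + convergentDen β n) = sturmian β k := by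
  have hfloor (j : ℤ) (hj : 1 ≤ j) (hjq : j < convergentDen β (n + 1)) :=
    floor_add_convergentDen_mul hβ hirr n (by omega) (abs_lt.mpr ⟨by omega, hjq⟩) (by omega)
  exact sturmian_add_eq_of_floor (hfloor k hk (by omega)) (hfloor (k + 1) (by omega) (by omega))

theorem sturmian_add_convergentDen_of_even (hβ : β ∈ Set.Icc (0 : ℝ) 1) (hirr : Irrational β)
    {n : ℕ} (hn : Even n) {k : ℤ} (hk : -(convergentDen β n : ℤ) < k)
    (hkq : k + 2 ≤ convergentDen β (n + 1)) :
    sturmian β (k + convergentDen β n) = sturmian β k := by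
  have hle := convergentDen_le_succ hβ hirr n
  have hfloor (j : ℤ) (hj : -(convergentDen β n : ℤ) < j) (hjq : j < convergentDen β (n + 1)) :
      ⌊((j + convergentDen β n : ℤ) : ℝ) * β⌋ = ⌊(j : ℝ) * β⌋ + convergentNum β n := by
    rcases eq_or_ne j 0 with rfl | hj0
    · simpa using floor_convergentDen_mul_of_even hβ hirr hn
    · exact floor_add_convergentDen_mul hβ hirr n hj0 (abs_lt.mpr ⟨by omega, hjq⟩) (by omega)
  exact sturmian_add_eq_of_floor (hfloor k hk (by omega)) (hfloor (k + 1) (by omega) (by omega))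

theorem sturmian_convergentDen_of_even (hβ : β ∈ Set.Icc (0 : ℝ) 1) (hirr : Irrational β) {n : ℕ}
    (hn : Even (n + 1)) : sturmian β (convergentDen β (n + 1)) = 0 := by
  rw [sturmian, Int.cast_natCast, floor_convergentDen_add_one_mul hβ hirr,
    floor_convergentDen_mul_of_even hβ hirr hn, sub_self]

theorem sturmian_convergentDen_of_odd (hβ : β ∈ Set.Icc (0 : ℝ) 1) (hirr : Irrational β) {n : ℕ}
    (hn : Odd (n + 1)) : sturmian β (convergentDen β (n + 1)) = 1 := by
  rw [sturmian, Int.cast_natCast, floor_convergentDen_add_one_mul hβ hirr,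
    floor_convergentDen_mul_of_odd hβ hirr hn, sub_sub_cancel]

theorem sturmian_eq_zero_of_lt (hβ : β ∈ Set.Icc (0 : ℝ) 1) (hirr : Irrational β) {k : ℤ}
    (hk : 1 ≤ k) (hkq : k < convergentDen β 1) : sturmian β k = 0 := by
  have h := floor_add_convergentDen_mul hβ hirr 0 (by omega) (abs_lt.mpr ⟨by omega, hkq⟩)
    (by omega)
  rw [convergentDen_zero] at h
  push_cast at h
  rw [sturmian, h, convergentNum, Nat.cast_zero, add_zero, sub_self]

theorem sturmian_eq_zero_or_one (hβ : β ∈ Set.Ico (0 : ℝ) 1) (k : ℤ) :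
    sturmian β k = 0 ∨ sturmian β k = 1 := by
  have hmono : ⌊(k : ℝ) * β⌋ ≤ ⌊((k : ℝ) + 1) * β⌋ := Int.floor_le_floor (by linarith [hβ.1])
  have hstep : ⌊((k : ℝ) + 1) * β⌋ < ⌊(k : ℝ) * β⌋ + 2 := by
    rw [Int.floor_lt]
    push_cast
    linarith [hβ.2, Int.lt_floor_add_one ((k : ℝ) * β)]
  rw [sturmian]
  omega

theorem hopping_congr {lam₁ lam₂ : ℝ} {j k : ℤ} (h : sturmian β j = sturmian β k) :
    hopping β lam₁ lam₂ j = hopping β lam₁ lam₂ k := by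
  rw [hopping, hopping, h]

theorem hopping_of_sturmian_eq_zero {lam₁ lam₂ : ℝ} {k : ℤ} (h : sturmian β k = 0) :
    hopping β lam₁ lam₂ k = lam₂ := by
  simp [hopping, h]

theorem hopping_of_sturmian_eq_one {lam₁ lam₂ : ℝ} {k : ℤ} (h : sturmian β k = 1) :
    hopping β lam₁ lam₂ k = lam₁ := by
  simp [hopping, h]

theorem hopping_ne_zero (hβ : β ∈ Set.Ico (0 : ℝ) 1) {lam₁ lam₂ : ℝ} (h₁ : lam₁ ≠ 0)
    (h₂ : lam₂ ≠ 0) (k : ℤ) : hopping β lam₁ lam₂ k ≠ 0 := by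
  rcases sturmian_eq_zero_or_one hβ k with h | h
  · rwa [hopping_of_sturmian_eq_zero h]
  · rwa [hopping_of_sturmian_eq_one h]

end Sturmian

/-! ### Escape and boundedness for the trace map -/

section TraceMap

open Filter

theorem sub_one_mul_abs_le_of_recurrence {f : ℕ → ℝ} {x : ℝ}
    (hf : ∀ p, f (p + 2) = x * f (p + 1) - f p) {k : ℕ} (hk : |f k| ≤ |f (k + 1)|) :
    (|x| - 1) * |f (k + 1)| ≤ |f (k + 2)| := by
  calc (|x| - 1) * |f (k + 1)| ≤ |x * f (k + 1)| - |f k| := by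
        rw [abs_mul, sub_one_mul]
        exact sub_le_sub_left hk _
    _ ≤ |f (k + 2)| := hf k ▸ abs_sub_abs_le_abs_sub _ _

theorem abs_lt_abs_succ_of_recurrence {f : ℕ → ℝ} {x : ℝ}
    (hf : ∀ p, f (p + 2) = x * f (p + 1) - f p) (hx : 2 < |x|) {k j : ℕ}
    (hk : |f k| < |f (k + 1)|) (hj : k ≤ j) : |f j| < |f (j + 1)| := by
  induction j, hj using Nat.le_induction with
  | base => exact hk
  | succ j _ ih =>
    refine lt_of_lt_of_le ?_ (sub_one_mul_abs_le_of_recurrence hf ih.le)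
    exact lt_mul_of_one_lt_left ((abs_nonneg _).trans_lt ih) (by linarith)

/-- The Fricke–Vogt polynomial `x² + y² + z² - xyz`, preserved by the trace map. -/
def frickeVogt (x y z : ℝ) : ℝ := x ^ 2 + y ^ 2 + z ^ 2 - x * y * z

theorem frickeVogt_of_recurrence {f : ℕ → ℝ} {x : ℝ}
    (hf : ∀ p, f (p + 2) = x * f (p + 1) - f p) (p : ℕ) :
    frickeVogt x (f p) (f (p + 1)) = frickeVogt x (f 0) (f 1) := by
  induction p with
  | zero => rfl
  | succ p ih =>
    rw [← ih, frickeVogt, frickeVogt, hf]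
    ring

theorem abs_le_four_add_abs_frickeVogt {x y z : ℝ} (hy : |y| ≤ 2) (hz : |z| ≤ 2) :
    |x| ≤ 4 + |frickeVogt x y z| := by
  have hmul : x * y * z ≤ |x| * 4 := by
    calc x * y * z ≤ |x| * (|y| * |z|) := by
          rw [mul_assoc, ← abs_mul, ← abs_mul]
          exact le_abs_self _
      _ ≤ |x| * 4 := by
          gcongr
          nlinarith [abs_nonneg y, abs_nonneg z]
  have hquad : |x| ^ 2 ≤ |x| * 4 + |frickeVogt x y z| := by
    have hle := le_abs_self (frickeVogt x y z)
    rw [sq_abs]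
    rw [frickeVogt] at hle ⊢
    linarith [sq_nonneg y, sq_nonneg z]
  by_contra! hlt
  nlinarith [abs_nonneg (frickeVogt x y z)]

theorem le_and_lt_mul_sub_of_mul_eq_sq_add_sq {y e u : ℝ} (hy : 2 < y) (he : 2 < e)
    (hu : u * (y * e) = y ^ 2 + e ^ 2) (hle : e ≤ u) : e ≤ y ∧ y < y * e - u := by
  have hey : e ≤ y := by
    by_contra! hlt
    nlinarith [mul_le_mul_of_nonneg_right hle (show 0 ≤ y * e by positivity)]
  have huy : u < y := by
    by_contra! hlt
    nlinarith [mul_le_mul_of_nonneg_right hlt (show 0 ≤ y * e by positivity),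
      pow_le_pow_left₀ (by positivity) hey 2,
      mul_pos (sub_pos.mpr he) (show 0 < y ^ 2 by positivity)]
  exact ⟨hey, by nlinarith⟩

/-- The relations between the traces `x n = tr B_n` and `t n p = tr (A_n B_n ^ p)` of pairs in
`SL₂` with `A_{n+1} = B_n` and `B_{n+1} = A_n B_n ^ (a n)`. -/
structure IsTraceOrbit (a : ℕ → ℕ) (x : ℕ → ℝ) (t : ℕ → ℕ → ℝ) : Prop where
  pos : ∀ n, 0 < a n
  add_two : ∀ n p, t n (p + 2) = x n * t n (p + 1) - t n p
  next : ∀ n, x (n + 1) = t n (a n)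
  next_zero : ∀ n, t (n + 1) 0 = x n
  next_one : ∀ n, t (n + 1) 1 = t n (a n + 1)

/-- The open condition on stage `n` of a trace orbit that forces the traces to tend to infinity. -/
def Escaped (x : ℕ → ℝ) (t : ℕ → ℕ → ℝ) (n : ℕ) : Prop :=
  2 < |x n| ∧ 2 < |t n 1| ∧ |t n 0| < |t n 1|

namespace IsTraceOrbit

variable {a : ℕ → ℕ} {x : ℕ → ℝ} {t : ℕ → ℕ → ℝ}

theorem frickeVogt_eq (h : IsTraceOrbit a x t) (n : ℕ) :
    frickeVogt (x n) (t n 0) (t n 1) = frickeVogt (x 0) (t 0 0) (t 0 1) := by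
  induction n with
  | zero => rfl
  | succ n ih =>
    rw [← ih, ← frickeVogt_of_recurrence (h.add_two n) (a n), h.next, h.next_zero, h.next_one,
      frickeVogt, frickeVogt]
    ring

theorem sub_one_mul_abs_next_le (h : IsTraceOrbit a x t) {n k : ℕ} (hx : 2 < |x n|)
    (hk : k < a n) (hlt : |t n k| < |t n (k + 1)|) :
    (|x n| - 1) * |x (n + 1)| ≤ |t (n + 1) 1| := by
  obtain ⟨j, hj⟩ := Nat.exists_eq_add_of_lt hk
  rw [h.next, h.next_one, hj]
  exact sub_one_mul_abs_le_of_recurrence (h.add_two n)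
    (abs_lt_abs_succ_of_recurrence (h.add_two n) hx hlt (Nat.le_add_right k j)).le

theorem escaped_succ_of_lt (h : IsTraceOrbit a x t) {n k : ℕ} (hx : 2 < |x n|)
    (hx' : 2 < |x (n + 1)|) (hk : k < a n) (hlt : |t n k| < |t n (k + 1)|) :
    Escaped x t (n + 1) := by
  have hgrow := h.sub_one_mul_abs_next_le hx hk hlt
  refine ⟨hx', by nlinarith, ?_⟩
  rw [h.next_zero]
  nlinarith

theorem abs_le_abs_next_of_escaped (h : IsTraceOrbit a x t) {n : ℕ} (he : Escaped x t n) :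
    |t n 1| ≤ |x (n + 1)| := by
  have hmono : ∀ j, |t n 1| ≤ |t n (j + 1)| := fun j => by
    induction j with
    | zero => exact le_rfl
    | succ j ih =>
      exact ih.trans
        (abs_lt_abs_succ_of_recurrence (h.add_two n) he.1 he.2.2 (Nat.zero_le (j + 1))).le
  rw [h.next, ← Nat.sub_add_cancel (h.pos n)]
  exact hmono _

theorem escaped_succ (h : IsTraceOrbit a x t) {n : ℕ} (he : Escaped x t n) :
    Escaped x t (n + 1) :=
  h.escaped_succ_of_lt he.1 (he.2.1.trans_le (h.abs_le_abs_next_of_escaped he)) (h.pos n) he.2.2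

theorem tendsto_abs_atTop_of_escaped (h : IsTraceOrbit a x t) {n : ℕ} (he : Escaped x t n) :
    Tendsto (fun m => |x m|) atTop atTop := by
  obtain ⟨r, hr, hrx, hrt⟩ : ∃ r : ℝ, 1 < r ∧ r + 1 ≤ |x n| ∧ r + 1 ≤ |t n 1| :=
    ⟨min |x n| |t n 1| - 1, by linarith [lt_min he.1 he.2.1],
      by linarith [min_le_left |x n| |t n 1|], by linarith [min_le_right |x n| |t n 1|]⟩
  have hgrow : ∀ j, Escaped x t (n + j) ∧ r + 1 ≤ |x (n + j)| ∧ r ^ j ≤ |t (n + j) 1| ∧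
      r + 1 ≤ |t (n + j) 1| := fun j => by
    induction j with
    | zero => exact ⟨he, hrx, by rw [pow_zero]; exact le_trans (by linarith) hrt, hrt⟩
    | succ j ih =>
      obtain ⟨hesc, hxj, htj, hrj⟩ := ih
      have hnext := h.abs_le_abs_next_of_escaped hesc
      have hstep : r * |t (n + j) 1| ≤ |t (n + j + 1) 1| :=
        calc r * |t (n + j) 1| ≤ (|x (n + j)| - 1) * |x (n + j + 1)| :=
              mul_le_mul (by linarith) hnext (abs_nonneg _) (by linarith)
          _ ≤ |t (n + j + 1) 1| := h.sub_one_mul_abs_next_le hesc.1 (h.pos _) hesc.2.2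
      refine ⟨h.escaped_succ hesc, hrj.trans hnext, ?_, ?_⟩
      · rw [pow_succ']
        exact (mul_le_mul_of_nonneg_left htj (by linarith)).trans hstep
      · exact le_trans (by nlinarith) hstep
  rw [← tendsto_add_atTop_iff_nat (n + 1)]
  refine tendsto_atTop_mono (fun j => ?_) (tendsto_pow_atTop_atTop_of_one_lt hr)
  have hj := hgrow j
  rw [show j + (n + 1) = n + j + 1 by ring]
  exact hj.2.2.1.trans (h.abs_le_abs_next_of_escaped hj.1)

theorem abs_succ_le_of_not_escaped (h : IsTraceOrbit a x t) {n : ℕ}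
    (hne : ¬ Escaped x t (n + 1)) (hx : 2 < |x n|) (hx' : 2 < |x (n + 1)|) {k : ℕ}
    (hk : k < a n) : |t n (k + 1)| ≤ |t n k| :=
  not_lt.mp fun hlt => hne (h.escaped_succ_of_lt hx hx' hk hlt)

theorem abs_next_le_of_not_escaped (h : IsTraceOrbit a x t) {n : ℕ}
    (hne : ¬ Escaped x t (n + 1)) (hx : 2 < |x n|) (hx' : 2 < |x (n + 1)|) {k : ℕ}
    (hk : k ≤ a n) : |x (n + 1)| ≤ |t n k| := by
  rw [h.next]
  exact Nat.decreasingInduction (motive := fun k _ => |t n (a n)| ≤ |t n k|)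
    (fun k hk ih => ih.trans (h.abs_succ_le_of_not_escaped hne hx hx' hk)) le_rfl hk

theorem abs_le_of_not_escaped (h : IsTraceOrbit a x t) {n : ℕ} (hne : ¬ Escaped x t (n + 1))
    (hx : |x n| ≤ 2) : |x (n + 1)| ≤ 4 + |frickeVogt (x 0) (t 0 0) (t 0 1)| := by
  rw [← h.frickeVogt_eq (n + 1)]
  rcases le_or_gt |x (n + 1)| 2 with hx' | hx'
  · linarith [abs_nonneg (frickeVogt (x (n + 1)) (t (n + 1) 0) (t (n + 1) 1))]
  · have ht0 : |t (n + 1) 0| ≤ 2 := by rwa [h.next_zero]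
    exact abs_le_four_add_abs_frickeVogt ht0
      (not_lt.mp fun ht1 => hne ⟨hx', ht1, ht0.trans_lt ht1⟩)

theorem abs_add_two_le_two_of_not_escaped (h : IsTraceOrbit a x t) {n : ℕ}
    (hne : ¬ Escaped x t (n + 2)) (hx : |x n| ≤ 2) (hx' : 2 < |x (n + 1)|) :
    |x (n + 2)| ≤ 2 := by
  by_contra! hlt
  have hle := h.abs_next_le_of_not_escaped hne hx' hlt (Nat.zero_le _)
  rw [h.next_zero] at hle
  exact absurd (hle.trans hx) hlt.not_ge

/-- Being above `2` twice in a row is impossible once the orbit has met `[-2, 2]`, and the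
Fricke–Vogt invariant bounds the traces in between. -/
theorem abs_le_and_returns_of_not_escaped (h : IsTraceOrbit a x t)
    (hne : ∀ n, ¬ Escaped x t n) {m n : ℕ} (hm : |x m| ≤ 2) (hn : m ≤ n) :
    |x n| ≤ 4 + |frickeVogt (x 0) (t 0 0) (t 0 1)| ∧ (|x n| ≤ 2 ∨ |x (n + 1)| ≤ 2) := by
  have hbound {n : ℕ} (hx : |x n| ≤ 2) : |x n| ≤ 4 + |frickeVogt (x 0) (t 0 0) (t 0 1)| := by
    linarith [abs_nonneg (frickeVogt (x 0) (t 0 0) (t 0 1))]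
  induction n, hn using Nat.le_induction with
  | base => exact ⟨hbound hm, Or.inl hm⟩
  | succ n _ ih =>
    rcases ih.2 with hx | hx
    · refine ⟨h.abs_le_of_not_escaped (hne _) hx, ?_⟩
      exact (le_or_gt _ _).imp_right (h.abs_add_two_le_two_of_not_escaped (hne _) hx)
    · exact ⟨hbound hx, Or.inl hx⟩

theorem abs_le_two_of_not_escaped_one (h : IsTraceOrbit a x t) (hne : ¬ Escaped x t 1)
    (hinit : x 0 ^ 2 + t 0 1 ^ 2 = x 0 * t 0 0 * t 0 1) : |x 0| ≤ 2 ∨ |x 1| ≤ 2 := by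
  by_contra! hlt
  obtain ⟨hx0, hx1⟩ := hlt
  have ht1 : 2 < |t 0 1| := hx1.trans_le (h.abs_next_le_of_not_escaped hne hx0 hx1 (h.pos 0))
  have hmono : |t 0 1| ≤ |t 0 0| := h.abs_succ_le_of_not_escaped hne hx0 hx1 (h.pos 0)
  have hprod : |t 0 0| * (|x 0| * |t 0 1|) = |x 0| ^ 2 + |t 0 1| ^ 2 := by
    rw [← abs_mul, ← abs_mul, sq_abs, sq_abs, mul_left_comm, ← mul_assoc, ← hinit,
      abs_of_nonneg (by positivity)]
  obtain ⟨hle, hlt⟩ := le_and_lt_mul_sub_of_mul_eq_sq_add_sq hx0 ht1 hprod hmono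
  have ht2 : |x 0| < |t 0 2| := by
    refine hlt.trans_le ?_
    rw [h.add_two 0 0, ← abs_mul]
    exact abs_sub_abs_le_abs_sub _ _
  rcases (Nat.succ_le_of_lt (h.pos 0)).eq_or_lt with ha | ha
  · have hone : t 1 1 = t 0 2 := by rw [h.next_one, ← ha]
    refine hne ⟨hx1, ?_, ?_⟩
    · rw [hone]
      exact hx0.trans ht2
    · rwa [hone, h.next_zero]
  · have hdecr : |t 0 2| ≤ |t 0 1| := h.abs_succ_le_of_not_escaped hne hx0 hx1 ha
    exact (hdecr.trans hle).not_gt ht2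

end IsTraceOrbit

end TraceMap

/-! ### Transfer matrices -/

section TransferMatrices

theorem det_stepMatrix {a : ℝ} (ha : a ≠ 0) (E : ℝ) : (stepMatrix a E).det = 1 := by
  rw [stepMatrix, Matrix.det_smul, Matrix.det_fin_two_of, Fintype.card_fin]
  field_simp
  ring

theorem trace_stepMatrix (a E : ℝ) : (stepMatrix a E).trace = E / a := by
  simp [stepMatrix, Matrix.trace_fin_two, div_eq_inv_mul]

theorem trace_stepMatrix_mul_adjugate {a b : ℝ} (ha : a ≠ 0) (hb : b ≠ 0) (E : ℝ) :
    (stepMatrix a E * (stepMatrix b E).adjugate).trace = a / b + b / a := by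
  simp only [stepMatrix, Matrix.adjugate_fin_two, Matrix.trace_fin_two, Matrix.mul_apply,
    Fin.sum_univ_two, Matrix.smul_apply, Matrix.of_apply, Matrix.cons_val, smul_eq_mul]
  field_simp
  ring

theorem stepMatrix_mul_adjugate_mul {b : ℝ} (hb : b ≠ 0) (a E : ℝ) :
    stepMatrix a E * (stepMatrix b E).adjugate * stepMatrix b E = stepMatrix a E := by
  rw [mul_assoc, Matrix.adjugate_mul, det_stepMatrix hb, one_smul, mul_one]

theorem continuous_stepMatrix (a : ℝ) : Continuous (stepMatrix a) := by
  have h : Continuous fun E : ℝ => !![E, -1; a ^ 2, 0] := continuous_matrix fun i j => by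
    fin_cases i <;> fin_cases j <;> first | exact continuous_id | exact continuous_const
  exact h.const_smul (1 / a)

theorem transferProduct_zero (a : ℤ → ℝ) (E : ℝ) : transferProduct a E 0 = 1 := rfl

theorem transferProduct_succ (a : ℤ → ℝ) (E : ℝ) (n : ℕ) : transferProduct a E (n + 1)
    = stepMatrix (a ((n : ℤ) + 1)) E * transferProduct a E n := rfl

theorem det_transferProduct {a : ℤ → ℝ} (ha : ∀ k, a k ≠ 0) (E : ℝ) (n : ℕ) :
    (transferProduct a E n).det = 1 := by
  induction n with
  | zero => exact Matrix.det_one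
  | succ n ih => rw [transferProduct_succ, Matrix.det_mul, ih, det_stepMatrix (ha _), one_mul]

theorem transferProduct_add (a : ℤ → ℝ) (E : ℝ) (n m : ℕ) : transferProduct a E (n + m)
    = transferProduct (fun k => a (k + m)) E n * transferProduct a E m := by
  induction n with
  | zero => rw [transferProduct_zero, one_mul, zero_add]
  | succ n ih =>
    rw [add_right_comm, transferProduct_succ, ih, transferProduct_succ, mul_assoc, Nat.cast_add,
      add_right_comm (n : ℤ)]

theorem transferProduct_congr {a b : ℤ → ℝ} (E : ℝ) {n : ℕ}
    (h : ∀ k : ℤ, 1 ≤ k → k ≤ n → a k = b k) : transferProduct a E n = transferProduct b E n := by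
  induction n with
  | zero => rfl
  | succ n ih =>
    rw [transferProduct_succ, transferProduct_succ, h (n + 1) (by omega) (by omega),
      ih fun k hk hkn => h k hk (by omega)]

theorem transferProduct_const (c E : ℝ) (n : ℕ) :
    transferProduct (fun _ => c) E n = stepMatrix c E ^ n := by
  induction n with
  | zero => rfl
  | succ n ih => rw [transferProduct_succ, ih, pow_succ']

theorem transferProduct_add_mul_of_periodic {a : ℤ → ℝ} (E : ℝ) {q r j : ℕ}
    (h : ∀ k : ℤ, 1 ≤ k → k + q ≤ (r + j * q : ℕ) → a (k + q) = a k) :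
    transferProduct a E (r + j * q) = transferProduct a E r * transferProduct a E q ^ j := by
  induction j with
  | zero => rw [zero_mul, add_zero, pow_zero, mul_one]
  | succ j ih =>
    have hlen : r + (j + 1) * q = r + j * q + q := by ring
    rw [hlen] at h ⊢
    rw [transferProduct_add, transferProduct_congr E fun k hk hkq => h k hk (by omega),
      ih fun k hk hkq => h k hk (by omega), pow_succ, mul_assoc]

theorem sq_eq_trace_smul_sub_one {R : Type*} [CommRing R] {B : Matrix (Fin 2) (Fin 2) R}
    (hB : B.det = 1) : B ^ 2 = B.trace • B - 1 := by
  nontriviality R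
  have h := B.aeval_self_charpoly
  rw [Matrix.charpoly_fin_two, hB] at h
  simp only [map_add, map_sub, map_mul, map_pow, Polynomial.aeval_X, Polynomial.aeval_C, map_one,
    Algebra.algebraMap_eq_smul_one, smul_mul_assoc, one_mul] at h
  rw [← sub_eq_zero, ← h]
  abel

theorem trace_mul_pow_add_two {R : Type*} [CommRing R] (A : Matrix (Fin 2) (Fin 2) R)
    {B : Matrix (Fin 2) (Fin 2) R} (hB : B.det = 1) (p : ℕ) :
    (A * B ^ (p + 2)).trace = B.trace * (A * B ^ (p + 1)).trace - (A * B ^ p).trace := by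
  rw [pow_add, sq_eq_trace_smul_sub_one hB, mul_sub, mul_one, mul_smul_comm, ← pow_succ, mul_sub,
    mul_smul_comm, Matrix.trace_sub, Matrix.trace_smul, smul_eq_mul]

end TransferMatrices

/-! ### Renormalization of the transfer matrices -/

section Renormalization

/-- The pairs obtained from `(A, B)` by iterating `(A, B) ↦ (B, A * B ^ a n)`, the action of the
continued fraction algorithm with digits `a` on words in two letters. -/
def renormPair {M : Type*} [Monoid M] (a : ℕ → ℕ) (A B : M) : ℕ → M × M
  | 0 => (A, B)
  | n + 1 => ((renormPair a A B n).2, (renormPair a A B n).1 * (renormPair a A B n).2 ^ a n)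

theorem det_renormPair (a : ℕ → ℕ) {A B : Matrix (Fin 2) (Fin 2) ℝ} (hA : A.det = 1)
    (hB : B.det = 1) (n : ℕ) :
    (renormPair a A B n).1.det = 1 ∧ (renormPair a A B n).2.det = 1 := by
  induction n with
  | zero => exact ⟨hA, hB⟩
  | succ n ih => simp [renormPair, ih.1, ih.2]

theorem isTraceOrbit_renormPair {a : ℕ → ℕ} (ha : ∀ n, 0 < a n) {A B : Matrix (Fin 2) (Fin 2) ℝ}
    (hA : A.det = 1) (hB : B.det = 1) :
    IsTraceOrbit a (fun n => (renormPair a A B n).2.trace)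
      fun n p => ((renormPair a A B n).1 * (renormPair a A B n).2 ^ p).trace where
  pos := ha
  add_two n := trace_mul_pow_add_two _ (det_renormPair a hA hB n).2
  next _ := rfl
  next_zero n := by rw [pow_zero, mul_one, renormPair]
  next_one n := by
    rw [renormPair, pow_one, Matrix.trace_mul_comm, mul_assoc, ← pow_succ]

theorem continuous_renormPair {X M : Type*} [TopologicalSpace X] [TopologicalSpace M] [Monoid M]
    [ContinuousMul M] (a : ℕ → ℕ) {A B : X → M} (hA : Continuous A) (hB : Continuous B) (n : ℕ) :
    Continuous fun x => renormPair a (A x) (B x) n := by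
  induction n with
  | zero => exact hA.prodMk hB
  | succ n ih => exact ih.snd.prodMk (ih.fst.mul (ih.snd.pow _))

/-- The renormalized pairs of transfer matrices of the off-diagonal model. The second matrix at
stage `0` is the step over `lam₂`; the first one is chosen so that their product is the step over
`lam₁`, which makes the second matrix at every stage `n ≥ 1` equal to `M_n`. -/
def sturmianPair (β lam₁ lam₂ E : ℝ) :
    ℕ → Matrix (Fin 2) (Fin 2) ℝ × Matrix (Fin 2) (Fin 2) ℝ :=
  renormPair (partialQuotient β) (stepMatrix lam₁ E * (stepMatrix lam₂ E).adjugate)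
    (stepMatrix lam₂ E)

/-- The traces `x_n` of the second matrices of `sturmianPair`; they agree with `traceSeq` for
`n ≥ 1`, and `x_0 = E / lam₂`. -/
def sturmianTrace (β lam₁ lam₂ E : ℝ) (n : ℕ) : ℝ := (sturmianPair β lam₁ lam₂ E n).2.trace

/-- The traces `tr (A_n B_n ^ p)` of the pairs `(A_n, B_n)` of `sturmianPair`. -/
def sturmianMixedTrace (β lam₁ lam₂ E : ℝ) (n p : ℕ) : ℝ :=
  ((sturmianPair β lam₁ lam₂ E n).1 * (sturmianPair β lam₁ lam₂ E n).2 ^ p).trace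

variable {β lam₁ lam₂ : ℝ}

theorem isTraceOrbit_sturmianTrace (hβ : β ∈ Set.Icc (0 : ℝ) 1) (hirr : Irrational β)
    (h₁ : lam₁ ≠ 0) (h₂ : lam₂ ≠ 0) (E : ℝ) :
    IsTraceOrbit (partialQuotient β) (sturmianTrace β lam₁ lam₂ E)
      (sturmianMixedTrace β lam₁ lam₂ E) :=
  isTraceOrbit_renormPair (partialQuotient_pos hβ hirr)
    (by simp [Matrix.det_adjugate, det_stepMatrix h₁, det_stepMatrix h₂]) (det_stepMatrix h₂ E)

theorem sturmianTrace_zero_sq_add (β : ℝ) (h₁ : lam₁ ≠ 0) (h₂ : lam₂ ≠ 0) (E : ℝ) :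
    sturmianTrace β lam₁ lam₂ E 0 ^ 2 + sturmianMixedTrace β lam₁ lam₂ E 0 1 ^ 2
      = sturmianTrace β lam₁ lam₂ E 0 * sturmianMixedTrace β lam₁ lam₂ E 0 0
        * sturmianMixedTrace β lam₁ lam₂ E 0 1 := by
  simp only [sturmianTrace, sturmianMixedTrace, sturmianPair, renormPair, pow_zero, mul_one,
    pow_one, stepMatrix_mul_adjugate_mul h₂, trace_stepMatrix, trace_stepMatrix_mul_adjugate h₁ h₂]
  field_simp

theorem continuous_sturmianPair (β lam₁ lam₂ : ℝ) (n : ℕ) :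
    Continuous fun E => sturmianPair β lam₁ lam₂ E n :=
  continuous_renormPair _
    ((continuous_stepMatrix lam₁).matrix_mul (continuous_stepMatrix lam₂).matrix_adjugate)
    (continuous_stepMatrix lam₂) n

theorem continuous_sturmianTrace (β lam₁ lam₂ : ℝ) (n : ℕ) :
    Continuous fun E => sturmianTrace β lam₁ lam₂ E n :=
  (continuous_sturmianPair β lam₁ lam₂ n).snd.matrix_trace

theorem continuous_sturmianMixedTrace (β lam₁ lam₂ : ℝ) (n p : ℕ) :
    Continuous fun E => sturmianMixedTrace β lam₁ lam₂ E n p :=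
  ((continuous_sturmianPair β lam₁ lam₂ n).fst.matrix_mul
    ((continuous_sturmianPair β lam₁ lam₂ n).snd.pow p)).matrix_trace

theorem transferMatrix_one (hβ : β ∈ Set.Icc (0 : ℝ) 1) (hirr : Irrational β) (lam₁ lam₂ E : ℝ) :
    transferMatrix β lam₁ lam₂ E 1
      = stepMatrix lam₁ E * stepMatrix lam₂ E ^ (convergentDen β 1 - 1) := by
  obtain ⟨m, hm⟩ := Nat.exists_eq_add_of_le' (convergentDen_pos hβ hirr 1)
  have hlast : hopping β lam₁ lam₂ ((m : ℤ) + 1) = lam₁ := hopping_of_sturmian_eq_one (by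
    exact_mod_cast hm ▸ sturmian_convergentDen_of_odd hβ hirr (n := 0) odd_one)
  rw [transferMatrix, hm, transferProduct_succ, hlast, Nat.add_sub_cancel, ← transferProduct_const,
    transferProduct_congr E fun k hk hkm =>
      hopping_of_sturmian_eq_zero (sturmian_eq_zero_of_lt hβ hirr hk (by omega))]

theorem transferMatrix_two (hβ : β ∈ Set.Icc (0 : ℝ) 1) (hirr : Irrational β) (lam₁ lam₂ E : ℝ) :
    transferMatrix β lam₁ lam₂ E 2
      = stepMatrix lam₂ E * transferMatrix β lam₁ lam₂ E 1 ^ partialQuotient β 1 := by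
  have hden : convergentDen β 2 = 0 + partialQuotient β 1 * convergentDen β 1 + 1 := by
    rw [zero_add]
    rfl
  have hpos := convergentDen_pos hβ hirr 1
  have hlast : hopping β lam₁ lam₂
      ((0 + partialQuotient β 1 * convergentDen β 1 : ℕ) + 1) = lam₂ :=
    hopping_of_sturmian_eq_zero (by
      exact_mod_cast hden ▸ sturmian_convergentDen_of_even hβ hirr (n := 1) even_two)
  rw [transferMatrix, hden, transferProduct_succ, hlast,
    transferProduct_add_mul_of_periodic E fun k hk hkq =>
      hopping_congr (sturmian_add_convergentDen hβ hirr 1 hk (by rw [hden]; omega)),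
    transferProduct_zero, one_mul, transferMatrix]

theorem transferMatrix_add_three (hβ : β ∈ Set.Icc (0 : ℝ) 1) (hirr : Irrational β)
    (lam₁ lam₂ E : ℝ) (n : ℕ) :
    transferMatrix β lam₁ lam₂ E (n + 3) = transferMatrix β lam₁ lam₂ E (n + 1)
      * transferMatrix β lam₁ lam₂ E (n + 2) ^ partialQuotient β (n + 2) := by
  have hden : convergentDen β (n + 3)
      = convergentDen β (n + 1) + partialQuotient β (n + 2) * convergentDen β (n + 2) :=
    add_comm _ _
  have hlt := one_lt_convergentDen_add_two hβ hirr n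
  simp only [transferMatrix]
  rw [hden, transferProduct_add_mul_of_periodic E fun k hk hkq =>
    hopping_congr (sturmian_add_convergentDen hβ hirr (n + 2) hk (by rw [hden]; omega))]

theorem sturmianPair_succ_snd (hβ : β ∈ Set.Icc (0 : ℝ) 1) (hirr : Irrational β)
    (lam₁ : ℝ) (h₂ : lam₂ ≠ 0) (E : ℝ) (n : ℕ) :
    (sturmianPair β lam₁ lam₂ E (n + 1)).2 = transferMatrix β lam₁ lam₂ E (n + 1) := by
  have hone : (sturmianPair β lam₁ lam₂ E 1).2 = transferMatrix β lam₁ lam₂ E 1 := by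
    have hden : partialQuotient β 0 = convergentDen β 1 - 1 + 1 :=
      (Nat.sub_add_cancel (convergentDen_pos hβ hirr 1)).symm
    rw [transferMatrix_one hβ hirr, sturmianPair, renormPair, hden, pow_succ', ← mul_assoc]
    exact congrArg (· * _) (stepMatrix_mul_adjugate_mul h₂ _ _)
  induction n using Nat.twoStepInduction with
  | zero => exact hone
  | one => rw [transferMatrix_two hβ hirr, ← hone]; rfl
  | more n ih ih' => rw [transferMatrix_add_three hβ hirr, ← ih, ← ih']; rfl

theorem sturmianTrace_eq_traceSeq (hβ : β ∈ Set.Icc (0 : ℝ) 1) (hirr : Irrational β)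
    (lam₁ : ℝ) (h₂ : lam₂ ≠ 0) (E : ℝ) {n : ℕ} (hn : 0 < n) :
    sturmianTrace β lam₁ lam₂ E n = traceSeq β lam₁ lam₂ E n := by
  rw [← Nat.sub_add_cancel hn, sturmianTrace, sturmianPair_succ_snd hβ hirr lam₁ h₂, traceSeq]

end Renormalization

/-! ### The pseudo-spectrum in terms of escape -/

section PseudoSpectrum

open Filter Topology

variable {β lam₁ lam₂ : ℝ}

/-- The energy `E` is escaping if the orbit of its traces under the trace map escapes. -/
def EscapingEnergy (β lam₁ lam₂ E : ℝ) : Prop :=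
  ∃ n, Escaped (sturmianTrace β lam₁ lam₂ E) (sturmianMixedTrace β lam₁ lam₂ E) n

theorem eventually_escaped_sturmianTrace {E : ℝ} {n : ℕ}
    (he : Escaped (sturmianTrace β lam₁ lam₂ E) (sturmianMixedTrace β lam₁ lam₂ E) n) :
    ∀ᶠ E' in 𝓝 E,
      Escaped (sturmianTrace β lam₁ lam₂ E') (sturmianMixedTrace β lam₁ lam₂ E') n := by
  have hx := (continuous_sturmianTrace β lam₁ lam₂ n).abs.tendsto E
  have ht (p : ℕ) := (continuous_sturmianMixedTrace β lam₁ lam₂ n p).abs.tendsto E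
  exact (hx.eventually_const_lt he.1).and
    (((ht 1).eventually_const_lt he.2.1).and ((ht 0).eventually_lt (ht 1) he.2.2))

theorem exists_eventually_two_lt_abs_traceSeq (hβ : β ∈ Set.Icc (0 : ℝ) 1)
    (hirr : Irrational β) (h₁ : lam₁ ≠ 0) (h₂ : lam₂ ≠ 0) {E : ℝ}
    (he : EscapingEnergy β lam₁ lam₂ E) :
    ∃ N, ∀ᶠ E' in 𝓝 E, ∀ n, N ≤ n → 2 < |traceSeq β lam₁ lam₂ E' n| := by
  obtain ⟨N, hN⟩ := he
  refine ⟨N + 1, (eventually_escaped_sturmianTrace hN).mono fun E' hE' n hn => ?_⟩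
  have horb := isTraceOrbit_sturmianTrace hβ hirr h₁ h₂ E'
  rw [← sturmianTrace_eq_traceSeq hβ hirr lam₁ h₂ E' (by omega)]
  have hesc : Escaped _ _ n :=
    Nat.le_induction hE' (fun _ _ => horb.escaped_succ) n (Nat.le_of_succ_le hn)
  exact hesc.1

theorem exists_forall_abs_traceSeq_le (hβ : β ∈ Set.Icc (0 : ℝ) 1)
    (hirr : Irrational β) (h₁ : lam₁ ≠ 0) (h₂ : lam₂ ≠ 0) {E : ℝ}
    (hE : ¬ EscapingEnergy β lam₁ lam₂ E) :
    ∃ C, ∀ n, 0 < n → |traceSeq β lam₁ lam₂ E n| ≤ C ∧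
      (|traceSeq β lam₁ lam₂ E n| ≤ 2 ∨ |traceSeq β lam₁ lam₂ E (n + 1)| ≤ 2) := by
  have horb := isTraceOrbit_sturmianTrace hβ hirr h₁ h₂ E
  have hne := not_exists.mp hE
  obtain ⟨m, hm1, hm⟩ : ∃ m, m ≤ 1 ∧ |sturmianTrace β lam₁ lam₂ E m| ≤ 2 :=
    (horb.abs_le_two_of_not_escaped_one (hne 1) (sturmianTrace_zero_sq_add β h₁ h₂ E)).elim
      (fun h => ⟨0, zero_le_one, h⟩) (fun h => ⟨1, le_rfl, h⟩)
  refine ⟨4 + |frickeVogt (sturmianTrace β lam₁ lam₂ E 0) (sturmianMixedTrace β lam₁ lam₂ E 0 0)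
    (sturmianMixedTrace β lam₁ lam₂ E 0 1)|, fun n hn => ?_⟩
  have h := horb.abs_le_and_returns_of_not_escaped hne hm (hm1.trans hn)
  rwa [sturmianTrace_eq_traceSeq hβ hirr lam₁ h₂ E hn,
    sturmianTrace_eq_traceSeq hβ hirr lam₁ h₂ E n.succ_pos] at h

theorem mem_pseudoSpectrum_iff (hβ : β ∈ Set.Icc (0 : ℝ) 1) (hirr : Irrational β)
    (h₁ : lam₁ ≠ 0) (h₂ : lam₂ ≠ 0) {E : ℝ} :
    E ∈ pseudoSpectrum β lam₁ lam₂ ↔ ¬ EscapingEnergy β lam₁ lam₂ E := by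
  constructor
  · rintro ⟨C, hC⟩ ⟨n, hn⟩
    have htend := (isTraceOrbit_sturmianTrace hβ hirr h₁ h₂ E).tendsto_abs_atTop_of_escaped hn
    obtain ⟨m, hlt, hm⟩ := ((htend.eventually_gt_atTop C).and (eventually_gt_atTop 0)).exists
    rw [sturmianTrace_eq_traceSeq hβ hirr lam₁ h₂ E hm] at hlt
    exact hlt.not_ge (hC m)
  · intro hE
    obtain ⟨C, hC⟩ := exists_forall_abs_traceSeq_le hβ hirr h₁ h₂ hE
    refine ⟨max C |traceSeq β lam₁ lam₂ E 0|, fun n => ?_⟩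
    rcases n.eq_zero_or_pos with rfl | hn
    · exact le_max_right _ _
    · exact le_max_of_le_left (hC n hn).1

theorem frequently_abs_traceSeq_le_two (hβ : β ∈ Set.Icc (0 : ℝ) 1) (hirr : Irrational β)
    (h₁ : lam₁ ≠ 0) (h₂ : lam₂ ≠ 0) {E : ℝ} (hE : ¬ EscapingEnergy β lam₁ lam₂ E) :
    ∃ᶠ n in atTop, |traceSeq β lam₁ lam₂ E n| ≤ 2 := by
  obtain ⟨C, hC⟩ := exists_forall_abs_traceSeq_le hβ hirr h₁ h₂ hE
  refine frequently_atTop.mpr fun N => ?_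
  rcases (hC (N + 1) N.succ_pos).2 with h | h
  exacts [⟨N + 1, by omega, h⟩, ⟨N + 2, by omega, h⟩]

end PseudoSpectrum

/-! ### Spectral theory of self-adjoint operators -/

section Spectral

open Filter
open scoped InnerProductSpace

variable {V : Type*} [NormedAddCommGroup V] [InnerProductSpace ℂ V]

theorem exists_mem_spectrum_norm_mul_norm_inv {A : Type*} [CStarAlgebra A] [Nontrivial A]
    {S : Aˣ} (hS : IsSelfAdjoint (S : A)) :
    ∃ z ∈ spectrum ℂ (S : A), ‖z‖ * ‖(↑S⁻¹ : A)‖ = 1 := by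
  have hinv : IsSelfAdjoint (↑S⁻¹ : A) := Ring.inverse_unit S ▸ hS.ringInverse
  obtain ⟨z, hz, hznorm⟩ := spectrum.exists_nnnorm_eq_spectralRadius (↑S⁻¹ : A)
  rw [hinv.spectralRadius_eq_nnnorm, ENNReal.coe_inj, ← NNReal.coe_inj, coe_nnnorm,
    coe_nnnorm] at hznorm
  refine ⟨z⁻¹, spectrum.inv₀_mem_iff.mpr hz, ?_⟩
  rw [← hznorm, norm_inv, inv_mul_cancel₀]
  exact norm_ne_zero_iff.mpr (spectrum.ne_zero_of_mem_of_unit hz)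

theorem exists_mem_spectrum_of_norm_apply_sub_lt [CompleteSpace V] {T : V →L[ℂ] V}
    (hT : IsSelfAdjoint T) {E c : ℝ} {ψ : V} (hψ : ‖T ψ - (E : ℂ) • ψ‖ < c * ‖ψ‖) :
    ∃ μ : ℝ, (μ : ℂ) ∈ spectrum ℂ T ∧ |μ - E| < c := by
  have hcψ : 0 < c * ‖ψ‖ := (norm_nonneg _).trans_lt hψ
  have hψ0 : 0 < ‖ψ‖ := (norm_nonneg ψ).lt_of_ne fun h => by simp [← h] at hcψ
  by_cases hE : (E : ℂ) ∈ spectrum ℂ T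
  · exact ⟨E, hE, by simpa using pos_of_mul_pos_left hcψ hψ0.le⟩
  have : Nontrivial V := ⟨ψ, 0, norm_pos_iff.mp hψ0⟩
  obtain ⟨S, hS⟩ := IsUnit.sub_iff.mp (spectrum.notMem_iff.mp hE)
  have hSadj : IsSelfAdjoint (S : V →L[ℂ] V) :=
    hS ▸ hT.sub (IsSelfAdjoint.algebraMap _ (Complex.conj_ofReal E))
  obtain ⟨z, hz, hznorm⟩ := exists_mem_spectrum_norm_mul_norm_inv hSadj
  have hSψ : (S : V →L[ℂ] V) ψ = T ψ - (E : ℂ) • ψ := by rw [hS]; rfl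
  have hψle : ‖ψ‖ ≤ ‖(↑S⁻¹ : V →L[ℂ] V)‖ * ‖(S : V →L[ℂ] V) ψ‖ := by
    have h := (↑S⁻¹ : V →L[ℂ] V).le_opNorm ((S : V →L[ℂ] V) ψ)
    rwa [← mul_apply_eq_comp, S.inv_mul] at h
  have hzψ : ‖z‖ * ‖ψ‖ < c * ‖ψ‖ := calc
    ‖z‖ * ‖ψ‖ ≤ ‖z‖ * (‖(↑S⁻¹ : V →L[ℂ] V)‖ * ‖(S : V →L[ℂ] V) ψ‖) := by gcongr
    _ = ‖T ψ - (E : ℂ) • ψ‖ := by rw [← mul_assoc, hznorm, one_mul, hSψ]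
    _ < c * ‖ψ‖ := hψ
  have hmem : z + E ∈ spectrum ℂ T := by rwa [spectrum.add_mem_iff, neg_add_eq_sub, ← hS]
  have hre := hT.mem_spectrum_eq_re hmem
  refine ⟨(z + E).re, hre ▸ hmem, ?_⟩
  rw [← Real.norm_eq_abs, ← Complex.norm_real, Complex.ofReal_sub, ← hre, add_sub_cancel_right]
  exact lt_of_mul_lt_mul_right hzψ hψ0.le

theorem mem_spectrum_of_forall_exists_norm_apply_sub_lt [CompleteSpace V] {T : V →L[ℂ] V}
    (hT : IsSelfAdjoint T) {E : ℝ} (h : ∀ c > 0, ∃ ψ : V, ‖T ψ - (E : ℂ) • ψ‖ < c * ‖ψ‖) :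
    (E : ℂ) ∈ spectrum ℂ T := by
  refine (Metric.mem_of_closed' (spectrum.isClosed T)).mpr fun c hc => ?_
  obtain ⟨ψ, hψ⟩ := h c hc
  obtain ⟨μ, hμ, hlt⟩ := exists_mem_spectrum_of_norm_apply_sub_lt hT hψ
  refine ⟨μ, hμ, ?_⟩
  rwa [dist_comm, Complex.dist_eq, ← Complex.ofReal_sub, Complex.norm_real]

theorem exists_eigenvector_of_norm_apply_sub_lt [FiniteDimensional ℂ V] {T : V →ₗ[ℂ] V}
    (hT : T.IsSymmetric) {E c : ℝ} {ψ : V} (hψ : ‖T ψ - (E : ℂ) • ψ‖ < c * ‖ψ‖) :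
    ∃ μ : ℝ, |μ - E| < c ∧ ∃ v : V, v ≠ 0 ∧ T v = (μ : ℂ) • v := by
  have : CompleteSpace V := FiniteDimensional.complete ℂ V
  obtain ⟨μ, hμ, hlt⟩ := exists_mem_spectrum_of_norm_apply_sub_lt
    (T := Module.End.toContinuousLinearMap V T)
    (ContinuousLinearMap.isSelfAdjoint_iff_isSymmetric.mpr hT) hψ
  rw [AlgEquiv.spectrum_eq] at hμ
  obtain ⟨v, hv⟩ := (Module.End.hasEigenvalue_iff_mem_spectrum.mpr hμ).exists_hasEigenvector
  exact ⟨μ, hlt, v, hv.2, hv.apply_eq_smul⟩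

theorem notMem_spectrum_of_le_norm_apply_sub [CompleteSpace V] {T : V →L[ℂ] V}
    (hT : IsSelfAdjoint T) {E c : ℝ} (hc : 0 < c)
    (h : ∀ ψ, c * ‖ψ‖ ≤ ‖T ψ - (E : ℂ) • ψ‖) : (E : ℂ) ∉ spectrum ℂ T := by
  set S : V →L[ℂ] V := T - algebraMap ℂ (V →L[ℂ] V) E
  have hS : IsSelfAdjoint S := hT.sub (IsSelfAdjoint.algebraMap _ (Complex.conj_ofReal E))
  have hanti : AntilipschitzWith (Real.toNNReal c⁻¹) S :=
    AddMonoidHomClass.antilipschitz_of_bound S fun ψ => by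
      rw [Real.coe_toNNReal _ (inv_pos.mpr hc).le, inv_mul_eq_div, le_div_iff₀' hc]
      exact h ψ
  rw [spectrum.notMem_iff, ← IsUnit.sub_iff, ContinuousLinearMap.isUnit_iff_bijective,
    ContinuousLinearMap.bijective_iff_dense_range_and_antilipschitz]
  refine ⟨?_, _, hanti⟩
  rw [Submodule.topologicalClosure_eq_top_iff, ContinuousLinearMap.orthogonal_range,
    ← ContinuousLinearMap.star_eq_adjoint, hS.star_eq, LinearMap.ker_eq_bot]
  exact hanti.injective

/-- The finitely supported element of `ℓ²(ℤ)` that agrees with `u` on the finite set `s`. -/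
def truncation (u : ℤ → ℂ) (s : Finset ℤ) : EllTwo := ∑ k ∈ s, lp.single 2 k (u k)

theorem truncation_apply (u : ℤ → ℂ) (s : Finset ℤ) (k : ℤ) :
    truncation u s k = if k ∈ s then u k else 0 := by
  rw [truncation, lp.coeFn_sum, Finset.sum_apply]
  simp only [lp.single_apply, Pi.single_apply, Finset.sum_ite_eq]

theorem norm_truncation_sq (u : ℤ → ℂ) (s : Finset ℤ) :
    ‖truncation u s‖ ^ 2 = ∑ k ∈ s, ‖u k‖ ^ 2 := by
  simpa [truncation] using lp.norm_sum_single (p := 2) (by norm_num) u s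

theorem tendsto_truncation (ψ : EllTwo) :
    Tendsto (truncation ψ) atTop (nhds ψ) :=
  lp.hasSum_single (p := 2) (by norm_num) ψ

theorem exists_truncation_norm_apply_sub_lt {T : EllTwo →L[ℂ] EllTwo} (hT : IsSelfAdjoint T)
    {E c : ℝ} (hc : 0 < c) (hE : (E : ℂ) ∈ spectrum ℂ T) :
    ∃ (u : ℤ → ℂ) (s : Finset ℤ),
      ‖T (truncation u s) - (E : ℂ) • truncation u s‖ < c * ‖truncation u s‖ := by
  obtain ⟨ψ, hψ⟩ : ∃ ψ, ‖T ψ - (E : ℂ) • ψ‖ < c * ‖ψ‖ := by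
    by_contra! h
    exact notMem_spectrum_of_le_norm_apply_sub hT hc h hE
  have hopen : IsOpen {φ : EllTwo | ‖T φ - (E : ℂ) • φ‖ < c * ‖φ‖} :=
    isOpen_lt (by fun_prop) (by fun_prop)
  exact ⟨ψ, ((tendsto_truncation ψ).eventually (hopen.mem_nhds hψ)).exists⟩

theorem exists_truncation_eq_zero_of_lt_abs (u : ℤ → ℂ) (s : Finset ℤ) :
    ∃ L : ℕ, ∀ k : ℤ, (L : ℤ) < |k| → truncation u s k = 0 := by
  refine ⟨∑ k ∈ s, k.natAbs, fun k hk => ?_⟩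
  rw [truncation_apply, if_neg fun hks => ?_]
  have := Finset.single_le_sum (f := Int.natAbs) (fun i _ => Nat.zero_le _) hks
  rw [Int.abs_eq_natAbs, Nat.cast_lt] at hk
  exact hk.not_ge this

theorem inner_weightedShift_left {c c' : ℤ → ℝ} (hc : ∃ C, ∀ n, |c n| ≤ C)
    (hc' : ∃ C, ∀ n, |c' n| ≤ C) {k k' : ℤ} (hk : k' = -k) (h : ∀ n, c' (n + k) = c n)
    (φ ψ : EllTwo) :
    ⟪weightedShift c hc k φ, ψ⟫_ℂ = ⟪φ, weightedShift c' hc' k' ψ⟫_ℂ := by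
  rw [lp.inner_eq_tsum, lp.inner_eq_tsum,
    ← (Equiv.addRight k).tsum_eq fun n => ⟪φ n, weightedShift c' hc' k' ψ n⟫_ℂ]
  refine tsum_congr fun n => ?_
  simp only [weightedShift_apply, Equiv.coe_addRight, h, hk, add_neg_cancel_right,
    RCLike.inner_apply, map_mul, Complex.conj_ofReal]
  ring

theorem isSelfAdjoint_jacobiOperator (a b : ℤ → ℝ) (ha : ∃ C, ∀ n, |a n| ≤ C)
    (hb : ∃ C, ∀ n, |b n| ≤ C) : IsSelfAdjoint (jacobiOperator a b ha hb) := by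
  rw [ContinuousLinearMap.isSelfAdjoint_iff_isSymmetric]
  intro φ ψ
  have ha' : ∃ C, ∀ n, |a (n - 1)| ≤ C := ha.imp fun _ h n => h (n - 1)
  have hright := inner_weightedShift_left ha ha' (k := 1) rfl (fun n => by simp) φ ψ
  have hleft := inner_weightedShift_left ha' ha (k := -1) (k' := 1) rfl
    (fun n => by rw [sub_eq_add_neg]) φ ψ
  have hdiag := inner_weightedShift_left hb hb (k := 0) (k' := 0) rfl (fun n => by simp) φ ψ
  simp only [jacobiOperator, ContinuousLinearMap.coe_coe, _root_.add_apply, inner_add_left,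
    inner_add_right, hright, hleft, hdiag]
  ring

/-- The Jacobi operator with off-diagonal sequence `a` and zero diagonal. -/
def offDiagonalJacobi (a : ℤ → ℝ) (ha : ∃ C, ∀ n, |a n| ≤ C) : EllTwo →L[ℂ] EllTwo :=
  jacobiOperator a (fun _ => 0) ha ⟨0, fun _ => by simp⟩

theorem offDiagonalJacobi_sub_smul_apply (a : ℤ → ℝ) (ha : ∃ C, ∀ n, |a n| ≤ C) (E : ℂ)
    (ψ : EllTwo) (k : ℤ) :
    (offDiagonalJacobi a ha ψ - E • ψ) k
      = (a k : ℂ) * ψ (k + 1) + a (k - 1) * ψ (k - 1) - E * ψ k := by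
  rw [lp.coeFn_sub, lp.coeFn_smul, Pi.sub_apply, Pi.smul_apply, smul_eq_mul, offDiagonalJacobi,
    jacobiOperator_apply, Complex.ofReal_zero, zero_mul, add_zero]

end Spectral

/-! ### Solutions of the eigenvalue equation -/

section FormalSolutions

open Matrix

variable {a : ℤ → ℝ} {E : ℝ} {v : ℤ → ℂ}

/-- Formal solutions, not necessarily square summable, of `H v = E v` on the half-line `k ≥ 1`,
for the Jacobi operator `H` with off-diagonal sequence `a`; only the values `v k` with `k ≥ 0`
matter. -/
def IsFormalSolution (a : ℤ → ℝ) (E : ℝ) (v : ℤ → ℂ) : Prop :=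
  ∀ k : ℤ, 1 ≤ k → (a k : ℂ) * v (k + 1) + a (k - 1) * v (k - 1) = E * v k

/-- The Cauchy data of a sequence at the site `k`, normalised so that `stepMatrix` propagates the
data of formal solutions. -/
def cauchyData (a : ℤ → ℝ) (v : ℤ → ℂ) (k : ℤ) : Fin 2 → ℂ := ![v (k + 1), a k * v k]

/-- The formal solution, on the sites `0, 1, …`, with Cauchy data `w` at `0`. -/
def formalSolution (a : ℤ → ℝ) (E : ℝ) (w : Fin 2 → ℂ) : ℕ → ℂ
  | 0 => w 1 / a 0
  | 1 => w 0
  | n + 2 => (E * formalSolution a E w (n + 1) - a n * formalSolution a E w n) / a (n + 1)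

theorem exists_isFormalSolution (ha : ∀ k, a k ≠ 0) (E : ℝ) (w : Fin 2 → ℂ) :
    ∃ v, IsFormalSolution a E v ∧ cauchyData a v 0 = w := by
  have ha' : ∀ k, (a k : ℂ) ≠ 0 := fun k => Complex.ofReal_ne_zero.mpr (ha k)
  refine ⟨fun k => formalSolution a E w k.toNat, fun k hk => ?_, ?_⟩
  · obtain ⟨n, rfl⟩ : ∃ n : ℕ, k = n + 1 := ⟨(k - 1).toNat, by omega⟩
    have hsucc : ((n : ℤ) + 1 + 1).toNat = n + 2 := by omega
    beta_reduce
    rw [add_sub_cancel_right, hsucc, Int.toNat_natCast_add_one, Int.toNat_natCast, formalSolution,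
      mul_div_cancel₀ _ (ha' _), sub_add_cancel]
  · funext i
    fin_cases i
    · rfl
    · exact mul_div_cancel₀ (w 1) (ha' 0)

theorem IsFormalSolution.mulVec_cauchyData (hv : IsFormalSolution a E v) (ha : ∀ k, a k ≠ 0)
    (n : ℕ) :
    Complex.ofRealHom.mapMatrix (transferProduct a E n) *ᵥ cauchyData a v 0
      = cauchyData a v n := by
  induction n with
  | zero => rw [transferProduct_zero, map_one, one_mulVec, Nat.cast_zero]
  | succ n ih =>
    have hne : (a (n + 1) : ℂ) ≠ 0 := Complex.ofReal_ne_zero.mpr (ha _)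
    have hstep := hv (n + 1) (by omega)
    rw [add_sub_cancel_right] at hstep
    rw [transferProduct_succ, map_mul, ← mulVec_mulVec, ih, Nat.cast_succ]
    ext i
    fin_cases i <;>
      simp only [stepMatrix, cauchyData, RingHom.mapMatrix_apply, mulVec, dotProduct,
        Fin.sum_univ_two, map_apply, Matrix.smul_apply, of_apply, cons_val, smul_eq_mul,
        Fin.zero_eta, Fin.mk_one, Complex.ofRealHom_eq_coe, Complex.ofReal_mul, Complex.ofReal_div,
        Complex.ofReal_neg, Complex.ofReal_one, Complex.ofReal_zero, Complex.ofReal_pow]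
    · field_simp
      linear_combination -hstep
    · field_simp
      ring

theorem IsFormalSolution.apply_add (hv : IsFormalSolution a E v) (ha : ∀ k, a k ≠ 0) {q : ℕ}
    {z : ℂ} (hz : Complex.ofRealHom.mapMatrix (transferProduct a E q) *ᵥ cauchyData a v 0
      = z • cauchyData a v 0) {k : ℤ} (hk : 1 ≤ k)
    (hper : ∀ j : ℤ, 1 ≤ j → j < k → a (j + q) = a j) :
    v (k + q) = z * v k := by
  obtain ⟨n, rfl⟩ : ∃ n : ℕ, k = n + 1 := ⟨(k - 1).toNat, by omega⟩
  have h := hv.mulVec_cauchyData ha (n + q)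
  rw [transferProduct_add, transferProduct_congr E fun j hj hjn => hper j hj (by omega), map_mul,
    ← mulVec_mulVec, hz, mulVec_smul, hv.mulVec_cauchyData ha] at h
  rw [add_right_comm, ← Nat.cast_add]
  exact (congrFun h 0).symm

theorem IsFormalSolution.ne_zero_or_ne_zero (hv : IsFormalSolution a E v)
    (h0 : cauchyData a v 0 ≠ 0) : v 1 ≠ 0 ∨ v 2 ≠ 0 := by
  by_contra! h
  have hstep := hv 1 le_rfl
  norm_num [h.1, h.2] at hstep
  refine h0 ?_
  simp [cauchyData, h.1, hstep]

theorem exists_mulVec_eq_smul_iff {K : Type*} [Field K] {M : Matrix (Fin 2) (Fin 2) K} {z : K} :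
    (∃ w ≠ 0, M *ᵥ w = z • w) ↔ z ^ 2 - M.trace * z + M.det = 0 := by
  have hdet : (M - z • (1 : Matrix (Fin 2) (Fin 2) K)).det = z ^ 2 - M.trace * z + M.det := by
    simp only [det_fin_two, trace_fin_two, Matrix.sub_apply, Matrix.smul_apply, one_apply_eq,
      smul_eq_mul, one_apply_ne zero_ne_one, one_apply_ne one_ne_zero]
    ring
  rw [← hdet, ← exists_mulVec_eq_zero_iff]
  simp only [sub_mulVec, smul_mulVec, one_mulVec, sub_eq_zero]

theorem exists_norm_eq_one_and_sq_sub_mul_add_one {D : ℝ} (hD : |D| ≤ 2) :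
    ∃ z : ℂ, ‖z‖ = 1 ∧ z ^ 2 - D * z + 1 = 0 := by
  obtain ⟨hlo, hhi⟩ := abs_le.mp hD
  have hcos : 2 * Complex.cos (Real.arccos (D / 2)) = D := by
    rw [← Complex.ofReal_cos, Real.cos_arccos (by linarith) (by linarith)]
    push_cast
    ring
  refine ⟨Complex.exp (Real.arccos (D / 2) * Complex.I), Complex.norm_exp_ofReal_mul_I _, ?_⟩
  rw [← hcos, Complex.two_cos, add_mul, ← sq, ← Complex.exp_add, neg_mul, neg_add_cancel,
    Complex.exp_zero]
  ring

theorem exists_isFormalSolution_norm_add_eq (ha : ∀ k, a k ≠ 0) {q : ℕ}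
    (hper : ∀ k : ℤ, 1 ≤ k → k < q → a (k + q) = a k)
    (htr : |(transferProduct a E q).trace| ≤ 2) :
    ∃ v, IsFormalSolution a E v ∧ cauchyData a v 0 ≠ 0 ∧
      ∀ k : ℤ, 1 ≤ k → k ≤ q → ‖v (k + q)‖ = ‖v k‖ := by
  obtain ⟨z, hz, hchar⟩ := exists_norm_eq_one_and_sq_sub_mul_add_one htr
  have hroot : z ^ 2 - (Complex.ofRealHom.mapMatrix (transferProduct a E q)).trace * z
      + (Complex.ofRealHom.mapMatrix (transferProduct a E q)).det = 0 := by
    rw [← RingHom.map_det, det_transferProduct ha, map_one, RingHom.mapMatrix_apply,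
      ← AddMonoidHom.map_trace]
    exact hchar
  obtain ⟨w, hw0, hw⟩ := exists_mulVec_eq_smul_iff.mpr hroot
  obtain ⟨v, hv, rfl⟩ := exists_isFormalSolution ha E w
  refine ⟨v, hv, hw0, fun k hk hkq => ?_⟩
  rw [hv.apply_add ha hw hk fun j hj hjk => hper j hj (by omega), norm_mul, hz, one_mul]

end FormalSolutions

/-! ### Approximate eigenvectors from repeated blocks -/

section Tent

/-- The tent function of slopes `±1`, supported in `{2, …, 2q - 1}`; it localises a formal solution
to the window `{1, …, 2q}` formed by two consecutive periods. -/
def tent (q : ℕ) (k : ℤ) : ℤ := max 0 (min (k - 1) (2 * q - k))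

theorem tent_eq_zero {q : ℕ} {k : ℤ} (hk : k ≤ 1 ∨ 2 * q ≤ k) : tent q k = 0 := by
  rw [tent]
  omega

theorem abs_tent_sub_le (q : ℕ) {j k : ℤ} (hjk : |j - k| ≤ 1) :
    |tent q j - tent q k| ≤ 1 := by
  rw [abs_le] at hjk ⊢
  rw [tent, tent]
  omega

theorem tent_add_tent {q : ℕ} {k : ℤ} (hk : 1 ≤ k) (hkq : k ≤ q) :
    tent q k + tent q (k + q) = q - 1 := by
  rw [tent, tent]
  omega

theorem sum_Ioc_two_mul (f : ℤ → ℝ) (q : ℕ) :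
    ∑ k ∈ Finset.Ioc 0 (2 * q : ℤ), f k = ∑ k ∈ Finset.Ioc 0 (q : ℤ), (f k + f (k + q)) := by
  have hmap : Finset.Ioc (q : ℤ) (2 * q)
      = (Finset.Ioc 0 (q : ℤ)).map (addRightEmbedding (q : ℤ)) := by
    rw [Finset.map_add_right_Ioc, zero_add, two_mul]
  rw [← Finset.Ioc_union_Ioc_eq_Ioc (Nat.cast_nonneg q) (by omega : (q : ℤ) ≤ 2 * q),
    Finset.sum_union (Finset.Ioc_disjoint_Ioc_of_le le_rfl), hmap, Finset.sum_map,
    Finset.sum_add_distrib]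
  rfl

variable {a : ℤ → ℝ} {C E : ℝ} {q : ℕ} {u : ℤ → ℂ}

/-- The square-summable test sequence obtained by multiplying `u` with the tent function. -/
def tentTruncation (q : ℕ) (u : ℤ → ℂ) : EllTwo :=
  truncation (fun k => tent q k * u k) (Finset.Ioc 0 (2 * q))

theorem tentTruncation_apply (q : ℕ) (u : ℤ → ℂ) (k : ℤ) :
    tentTruncation q u k = tent q k * u k := by
  rw [tentTruncation, truncation_apply]
  split_ifs with hk
  · rfl
  · rw [Finset.mem_Ioc] at hk
    rw [tent_eq_zero (by omega), Int.cast_zero, zero_mul]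

theorem norm_tent_sub_mul_le (q : ℕ) (u : ℤ → ℂ) {j k : ℤ} (hjk : |j - k| ≤ 1) :
    ‖((tent q j - tent q k : ℤ) : ℂ) * u j‖ ≤ ‖truncation u (Finset.Ioc 0 (2 * q)) j‖ := by
  rw [truncation_apply, norm_mul, Complex.norm_intCast]
  split_ifs with hj
  · exact mul_le_of_le_one_left (norm_nonneg _) (mod_cast abs_tent_sub_le q hjk)
  · rw [Finset.mem_Ioc] at hj
    rw [abs_le] at hjk
    rw [tent_eq_zero (by omega), tent_eq_zero (by omega), sub_self, Int.cast_zero, abs_zero,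
      zero_mul, norm_zero]

theorem hasSum_norm_sq (ψ : EllTwo) : HasSum (fun k => ‖ψ k‖ ^ 2) (‖ψ‖ ^ 2) := by
  simpa using lp.hasSum_norm (p := 2) (by norm_num) ψ

theorem norm_le_of_norm_apply_le_neighbors {φ g : EllTwo} (hC : 0 ≤ C)
    (h : ∀ k, ‖φ k‖ ≤ C * (‖g (k + 1)‖ + ‖g (k - 1)‖)) : ‖φ‖ ≤ 2 * C * ‖g‖ := by
  have hright : HasSum (fun k => ‖g (k + 1)‖ ^ 2) (‖g‖ ^ 2) :=
    (Equiv.addRight (1 : ℤ)).hasSum_iff (f := fun k => ‖g k‖ ^ 2) |>.mpr (hasSum_norm_sq g)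
  have hleft : HasSum (fun k => ‖g (k - 1)‖ ^ 2) (‖g‖ ^ 2) :=
    (Equiv.subRight (1 : ℤ)).hasSum_iff (f := fun k => ‖g k‖ ^ 2) |>.mpr (hasSum_norm_sq g)
  have hle : ∀ k, ‖φ k‖ ^ 2 ≤ 2 * C ^ 2 * (‖g (k + 1)‖ ^ 2 + ‖g (k - 1)‖ ^ 2) := fun k => calc
    ‖φ k‖ ^ 2 ≤ (C * (‖g (k + 1)‖ + ‖g (k - 1)‖)) ^ 2 := by gcongr; exact h k
    _ ≤ C ^ 2 * (2 * (‖g (k + 1)‖ ^ 2 + ‖g (k - 1)‖ ^ 2)) := by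
      rw [mul_pow]; gcongr; exact add_sq_le
    _ = 2 * C ^ 2 * (‖g (k + 1)‖ ^ 2 + ‖g (k - 1)‖ ^ 2) := by ring
  have hsum := hasSum_le hle (hasSum_norm_sq φ) ((hright.add hleft).mul_left (2 * C ^ 2))
  refine le_of_sq_le_sq (hsum.trans_eq ?_) (by positivity)
  ring

theorem sub_one_mul_norm_truncation_le
    (hu : ∀ k : ℤ, 1 ≤ k → k ≤ q → ‖u (k + q)‖ = ‖u k‖) :
    (q - 1) * ‖truncation u (Finset.Ioc 0 (2 * q))‖ ≤ 2 * ‖tentTruncation q u‖ := by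
  refine le_of_sq_le_sq ?_ (by positivity)
  rw [mul_pow, mul_pow, tentTruncation, norm_truncation_sq, norm_truncation_sq, sum_Ioc_two_mul,
    sum_Ioc_two_mul, Finset.mul_sum, Finset.mul_sum]
  refine Finset.sum_le_sum fun k hk => ?_
  obtain ⟨hk0, hkq⟩ := Finset.mem_Ioc.mp hk
  have htent : (tent q k + tent q (k + q) : ℝ) = q - 1 := mod_cast tent_add_tent hk0 hkq
  simp only [norm_mul, mul_pow, Complex.norm_intCast, sq_abs, hu k hk0 hkq]
  rw [← htent]
  nlinarith [mul_nonneg (sq_nonneg ‖u k‖) (sq_nonneg (tent q k - tent q (k + q) : ℝ))]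

/- Multiplying a formal solution by a tent leaves only the discrete derivative of the tent, which is
bounded by `1`, whereas the tent itself is of size `q` on a fixed proportion of the mass of `u`. -/
theorem sub_one_mul_norm_offDiagonalJacobi_tentTruncation_le (hC : ∀ k, |a k| ≤ C)
    (hq : 1 ≤ q) (hu : IsFormalSolution a E u)
    (hnorm : ∀ k : ℤ, 1 ≤ k → k ≤ q → ‖u (k + q)‖ = ‖u k‖) :
    (q - 1) * ‖offDiagonalJacobi a ⟨C, hC⟩ (tentTruncation q u) - (E : ℂ) • tentTruncation q u‖
      ≤ 4 * C * ‖tentTruncation q u‖ := by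
  have hC0 : 0 ≤ C := (abs_nonneg _).trans (hC 0)
  have hq' : (1 : ℝ) ≤ q := mod_cast hq
  have hcommutator : ∀ k,
      (offDiagonalJacobi a ⟨C, hC⟩ (tentTruncation q u) - (E : ℂ) • tentTruncation q u) k
        = a k * ((tent q (k + 1) - tent q k : ℤ) * u (k + 1))
          + a (k - 1) * ((tent q (k - 1) - tent q k : ℤ) * u (k - 1)) := fun k => by
    have heq : (tent q k : ℂ) * (a k * u (k + 1) + a (k - 1) * u (k - 1) - E * u k) = 0 := by
      rcases lt_or_ge k 1 with hk | hk
      · rw [tent_eq_zero (Or.inl hk.le), Int.cast_zero, zero_mul]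
      · rw [hu k hk, sub_self, mul_zero]
    rw [offDiagonalJacobi_sub_smul_apply, tentTruncation_apply, tentTruncation_apply,
      tentTruncation_apply]
    push_cast
    linear_combination heq
  have hle := norm_le_of_norm_apply_le_neighbors (g := truncation u (Finset.Ioc 0 (2 * q))) hC0
    fun k => by
      rw [hcommutator, mul_add]
      refine (norm_add_le _ _).trans (add_le_add ?_ ?_) <;> rw [norm_mul, Complex.norm_real]
      · exact mul_le_mul (hC _) (norm_tent_sub_mul_le q u (by simp)) (norm_nonneg _) hC0
      · exact mul_le_mul (hC _) (norm_tent_sub_mul_le q u (by simp)) (norm_nonneg _) hC0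
  calc (q - 1) * ‖_‖ ≤ (q - 1) * (2 * C * ‖truncation u (Finset.Ioc 0 (2 * q))‖) := by
        gcongr
    _ = 2 * C * ((q - 1) * ‖truncation u (Finset.Ioc 0 (2 * q))‖) := by ring
    _ ≤ 2 * C * (2 * ‖tentTruncation q u‖) := by
        exact mul_le_mul_of_nonneg_left (sub_one_mul_norm_truncation_le hnorm) (by positivity)
    _ = 4 * C * ‖tentTruncation q u‖ := by ring

theorem tentTruncation_ne_zero (hq : 2 ≤ q) (hu : IsFormalSolution a E u)
    (h0 : cauchyData a u 0 ≠ 0) (hnorm : ∀ k : ℤ, 1 ≤ k → k ≤ q → ‖u (k + q)‖ = ‖u k‖) :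
    tentTruncation q u ≠ 0 := by
  have hq' : (2 : ℝ) ≤ q := mod_cast hq
  intro h
  have hle := sub_one_mul_norm_truncation_le hnorm
  rw [h, norm_zero, mul_zero] at hle
  have hzero : truncation u (Finset.Ioc 0 (2 * q)) = 0 :=
    norm_le_zero_iff.mp (nonpos_of_mul_nonpos_right hle (by linarith))
  have hu0 : ∀ k ∈ Finset.Ioc 0 (2 * q : ℤ), u k = 0 := fun k hk => by
    have := truncation_apply u (Finset.Ioc 0 (2 * q)) k
    rwa [hzero, if_pos hk, eq_comm] at this
  rcases hu.ne_zero_or_ne_zero h0 with h1 | h2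
  · exact h1 (hu0 1 (Finset.mem_Ioc.mpr (by omega)))
  · exact h2 (hu0 2 (Finset.mem_Ioc.mpr (by omega)))

theorem exists_sub_one_mul_norm_offDiagonalJacobi_sub_le (ha : ∀ k, a k ≠ 0)
    (hC : ∀ k, |a k| ≤ C) (hq : 2 ≤ q) (hper : ∀ k : ℤ, 1 ≤ k → k < q → a (k + q) = a k)
    (htr : |(transferProduct a E q).trace| ≤ 2) :
    ∃ ψ ≠ 0, (q - 1) * ‖offDiagonalJacobi a ⟨C, hC⟩ ψ - (E : ℂ) • ψ‖ ≤ 4 * C * ‖ψ‖ := by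
  obtain ⟨u, hu, h0, hnorm⟩ := exists_isFormalSolution_norm_add_eq ha hper htr
  exact ⟨tentTruncation q u, tentTruncation_ne_zero hq hu h0 hnorm,
    sub_one_mul_norm_offDiagonalJacobi_tentTruncation_le hC (by omega) hu hnorm⟩

end Tent

/-! ### Cyclic restrictions -/

section Cyclic

open Matrix

variable {q : ℕ}

/-- The Jacobi operator with off-diagonal entries `b` on the cycle `ZMod q`; it is the cyclic
counterpart of `offDiagonalJacobi`. -/
def cyclicJacobi (b : ZMod q → ℝ) : EuclideanSpace ℂ (ZMod q) →ₗ[ℂ] EuclideanSpace ℂ (ZMod q) where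
  toFun ψ := WithLp.toLp 2 fun z => b z * ψ (z + 1) + b (z - 1) * ψ (z - 1)
  map_add' φ ψ := by
    ext z
    simp only [PiLp.add_apply]
    ring
  map_smul' r ψ := by
    ext z
    simp only [PiLp.smul_apply, smul_eq_mul, RingHom.id_apply]
    ring

theorem cyclicJacobi_apply (b : ZMod q → ℝ) (ψ : EuclideanSpace ℂ (ZMod q)) (z : ZMod q) :
    cyclicJacobi b ψ z = b z * ψ (z + 1) + b (z - 1) * ψ (z - 1) := rfl

theorem isFormalSolution_comp_intCast {b : ZMod q → ℝ} {E : ℝ} {ψ : EuclideanSpace ℂ (ZMod q)}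
    (hE : cyclicJacobi b ψ = (E : ℂ) • ψ) :
    IsFormalSolution (fun k => b k) E fun k => ψ k := fun k _ => by
  have h := congrArg (fun φ => φ (k : ZMod q)) hE
  simpa [cyclicJacobi_apply] using h

variable [NeZero q]

theorem isSymmetric_cyclicJacobi (b : ZMod q → ℝ) : (cyclicJacobi b).IsSymmetric := by
  intro φ ψ
  have hright := Equiv.sum_comp (Equiv.addRight (1 : ZMod q))
    fun z => ψ (z - 1) * (b (z - 1) * starRingEnd ℂ (φ z))
  have hleft := Equiv.sum_comp (Equiv.addRight (1 : ZMod q))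
    fun z => ψ z * (b (z - 1) * starRingEnd ℂ (φ (z - 1)))
  simp only [Equiv.coe_addRight, add_sub_cancel_right] at hright hleft
  simp only [PiLp.inner_apply, cyclicJacobi_apply, RCLike.inner_apply, map_add, map_mul,
    Complex.conj_ofReal, add_mul, mul_add, Finset.sum_add_distrib]
  rw [hright, ← hleft, add_comm]
  congr 1 <;> exact Finset.sum_congr rfl fun z _ => by ring

theorem trace_transferProduct_eq_two_of_cyclicJacobi_eq {b : ZMod q → ℝ} (hb : ∀ z, b z ≠ 0) {E : ℝ}
    {ψ : EuclideanSpace ℂ (ZMod q)} (hψ : ψ ≠ 0) (hE : cyclicJacobi b ψ = (E : ℂ) • ψ) :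
    (transferProduct (fun k => b k) E q).trace = 2 := by
  have ha : ∀ k : ℤ, b k ≠ 0 := fun k => hb k
  have hcauchy := (isFormalSolution_comp_intCast hE).mulVec_cauchyData ha
  have hfix : cauchyData (fun k => b k) (fun k => ψ k) q
      = (1 : ℂ) • cauchyData (fun k => b k) (fun k => ψ k) 0 := by
    simp [cauchyData]
  have hne : cauchyData (fun k => b k) (fun k => ψ k) 0 ≠ 0 := fun h0 => hψ <| by
    ext z
    have h := congrFun (hcauchy (z - 1).val) 0
    rw [h0, mulVec_zero] at h
    simpa [cauchyData] using h.symm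
  have hroot := exists_mulVec_eq_smul_iff.mp ⟨_, hne, (hcauchy q).trans hfix⟩
  rw [← RingHom.map_det, det_transferProduct ha, map_one, RingHom.mapMatrix_apply,
    ← AddMonoidHom.map_trace, one_pow, mul_one, sub_add_eq_add_sub, one_add_one_eq_two,
    sub_eq_zero] at hroot
  exact Complex.ofReal_injective hroot.symm

theorem apply_valMinAbs_intCast {α : Type*} {f : ℤ → α} {j : ℤ} (hj : -(q : ℤ) < j)
    (hj' : j ≤ q) (hlo : 2 * j ≤ -q → f (j + q) = f j) (hhi : q < 2 * j → f (j - q) = f j) :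
    f (j : ZMod q).valMinAbs = f j := by
  rcases le_or_gt (2 * j) (-q) with h | h
  · rw [(ZMod.valMinAbs_spec (j : ZMod q) (j + q)).mpr ⟨by simp, by omega, by omega⟩, hlo h]
  rcases lt_or_ge (q : ℤ) (2 * j) with h' | h'
  · rw [(ZMod.valMinAbs_spec (j : ZMod q) (j - q)).mpr ⟨by simp, by omega, by omega⟩, hhi h']
  · rw [(ZMod.valMinAbs_spec (j : ZMod q) j).mpr ⟨rfl, by omega, by omega⟩]

theorem apply_valMinAbs_of_add_eq {α : Type*} {f : ℤ → α}
    (hper : ∀ k : ℤ, -(q : ℤ) < k → k ≤ 0 → f (k + q) = f k) {j : ℤ} (hj : -(q : ℤ) < j)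
    (hj' : j ≤ q) : f (j : ZMod q).valMinAbs = f j :=
  apply_valMinAbs_intCast hj hj' (fun _ => hper j hj (by omega)) fun _ => by
    rw [← hper (j - q) (by omega) (by omega), sub_add_cancel]

/-- The restriction of `φ` to the representatives in `(-q/2, q/2]` of the residues modulo `q`. -/
def cyclicRestriction (q : ℕ) (φ : EllTwo) : EuclideanSpace ℂ (ZMod q) :=
  WithLp.toLp 2 fun z => φ z.valMinAbs

theorem cyclicRestriction_apply (q : ℕ) (φ : EllTwo) (z : ZMod q) :
    cyclicRestriction q φ z = φ z.valMinAbs := rfl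

theorem norm_cyclicRestriction {φ : EllTwo} {L : ℕ} (hL : 2 * L < q)
    (hφ : ∀ k : ℤ, (L : ℤ) < |k| → φ k = 0) :
    ‖cyclicRestriction q φ‖ = ‖φ‖ := by
  rw [← sq_eq_sq₀ (norm_nonneg _) (norm_nonneg _), EuclideanSpace.norm_sq_eq]
  have hsum : HasSum ((fun k => ‖φ k‖ ^ 2) ∘ (ZMod.valMinAbs : ZMod q → ℤ)) (‖φ‖ ^ 2) := by
    refine ZMod.injective_valMinAbs.hasSum_iff (fun k hk => ?_) |>.mpr (hasSum_norm_sq φ)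
    rw [hφ k, norm_zero, zero_pow two_ne_zero]
    by_contra! h
    rw [abs_le] at h
    exact hk ⟨k, (ZMod.valMinAbs_spec _ _).mpr ⟨rfl, by omega, by omega⟩⟩
  exact (hasSum_fintype _).unique hsum

theorem cyclicJacobi_sub_smul_cyclicRestriction {a : ℤ → ℝ} (ha : ∃ C, ∀ k, |a k| ≤ C)
    (hper : ∀ k : ℤ, -(q : ℤ) < k → k ≤ 0 → a (k + q) = a k) {ψ : EllTwo}
    {L : ℕ} (hL : 2 * L + 2 < q) (hψ : ∀ k : ℤ, (L : ℤ) < |k| → ψ k = 0) (E : ℝ) :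
    cyclicJacobi (fun z => a z.valMinAbs) (cyclicRestriction q ψ)
        - (E : ℂ) • cyclicRestriction q ψ
      = cyclicRestriction q (offDiagonalJacobi a ha ψ - (E : ℂ) • ψ) := by
  ext z
  obtain ⟨k, hk, hk', rfl⟩ : ∃ k : ℤ, -(q : ℤ) < k * 2 ∧ k * 2 ≤ q ∧ (k : ZMod q) = z :=
    ⟨z.valMinAbs, z.valMinAbs_mem_Ioc.1, z.valMinAbs_mem_Ioc.2, z.coe_valMinAbs⟩
  have hval : ∀ j : ℤ, |j - k| ≤ 1 → ψ (j : ZMod q).valMinAbs = ψ j := fun j hj => by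
    rw [abs_le] at hj
    refine apply_valMinAbs_intCast (by omega) (by omega) (fun _ => ?_) fun _ => ?_ <;>
      rw [hψ _ (lt_abs.mpr (by omega)), hψ j (lt_abs.mpr (by omega))]
  have hself : (k : ZMod q).valMinAbs = k := (ZMod.valMinAbs_spec _ _).mpr ⟨rfl, hk, hk'⟩
  have hsucc := hval (k + 1) (by simp)
  have hpred := hval (k - 1) (by simp)
  have hapred := apply_valMinAbs_of_add_eq hper (j := k - 1) (by omega) (by omega)
  push_cast at hsucc hpred hapred
  rw [PiLp.sub_apply, PiLp.smul_apply, cyclicJacobi_apply, cyclicRestriction_apply,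
    cyclicRestriction_apply, cyclicRestriction_apply, cyclicRestriction_apply, hsucc, hpred,
    hapred, hself, offDiagonalJacobi_sub_smul_apply, smul_eq_mul]

/- On a window of length `q` where `a` is `q`-periodic, an approximate eigenvector supported well
inside the window is also one of the cyclic operator, which has eigenvectors. -/
theorem exists_trace_transferProduct_eq_two {a : ℤ → ℝ} (ha0 : ∀ k, a k ≠ 0)
    (ha : ∃ C, ∀ k, |a k| ≤ C) (hper : ∀ k : ℤ, -(q : ℤ) < k → k ≤ 0 → a (k + q) = a k)
    {ψ : EllTwo} {L : ℕ} (hL : 2 * L + 2 < q) (hψ : ∀ k : ℤ, (L : ℤ) < |k| → ψ k = 0) {E c : ℝ}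
    (hE : ‖offDiagonalJacobi a ha ψ - (E : ℂ) • ψ‖ < c * ‖ψ‖) :
    ∃ E' : ℝ, |E' - E| < c ∧ (transferProduct a E' q).trace = 2 := by
  have hsupp : ∀ k : ℤ, ((L + 1 : ℕ) : ℤ) < |k| →
      (offDiagonalJacobi a ha ψ - (E : ℂ) • ψ) k = 0 := fun k hk => by
    rw [lt_abs] at hk
    rw [offDiagonalJacobi_sub_smul_apply, hψ k (lt_abs.mpr (by omega)),
      hψ (k + 1) (lt_abs.mpr (by omega)), hψ (k - 1) (lt_abs.mpr (by omega)), mul_zero, mul_zero,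
      mul_zero, add_zero, sub_zero]
  rw [← norm_cyclicRestriction (by omega) hsupp, ← norm_cyclicRestriction (q := q) (by omega) hψ,
    ← cyclicJacobi_sub_smul_cyclicRestriction ha hper hL hψ] at hE
  obtain ⟨E', hE', φ, hφ, heig⟩ :=
    exists_eigenvector_of_norm_apply_sub_lt (isSymmetric_cyclicJacobi _) hE
  refine ⟨E', hE', ?_⟩
  rw [← trace_transferProduct_eq_two_of_cyclicJacobi_eq (fun z => ha0 z.valMinAbs) hφ heig]
  exact congrArg trace (transferProduct_congr E' fun k hk hkq =>
    (apply_valMinAbs_of_add_eq hper (by omega) hkq).symm)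

end Cyclic

/-! ### The spectrum and the pseudo-spectrum -/

section Spectrum

open Filter Topology

variable {β lam₁ lam₂ E : ℝ}

theorem isSelfAdjoint_offDiagonalOperator : IsSelfAdjoint (offDiagonalOperator β lam₁ lam₂) :=
  isSelfAdjoint_jacobiOperator _ _ _ _

theorem mem_spectrum_of_frequently_abs_traceSeq_le_two (hβ : β ∈ Set.Icc (0 : ℝ) 1)
    (hirr : Irrational β) (h₁ : lam₁ ≠ 0) (h₂ : lam₂ ≠ 0)
    (hE : ∃ᶠ n in atTop, |traceSeq β lam₁ lam₂ E n| ≤ 2) :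
    (E : ℂ) ∈ spectrum ℂ (offDiagonalOperator β lam₁ lam₂) := by
  obtain ⟨C, hC⟩ := hopping_bounded β lam₁ lam₂
  refine mem_spectrum_of_forall_exists_norm_apply_sub_lt isSelfAdjoint_offDiagonalOperator
    fun c hc => ?_
  obtain ⟨N, hN⟩ := exists_nat_gt (4 * C / c)
  obtain ⟨n, hn, htr⟩ := frequently_atTop.mp hE (N + 2)
  obtain ⟨m, rfl⟩ : ∃ m, n = m + 1 := ⟨n - 1, by omega⟩
  have hqN : N + 2 ≤ convergentDen β (m + 1) := hn.trans (le_convergentDen hβ hirr (m + 1))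
  have hadd : convergentDen β (m + 1) + 1 ≤ convergentDen β (m + 1 + 1) :=
    (Nat.add_le_add_left (convergentDen_pos hβ hirr m) _).trans (convergentDen_add_le hβ hirr m)
  obtain ⟨ψ, hψ, hle⟩ := exists_sub_one_mul_norm_offDiagonalJacobi_sub_le
    (hopping_ne_zero ⟨hβ.1, hβ.2.lt_of_ne hirr.ne_one⟩ h₁ h₂) hC (by omega)
    (fun k hk hkq => hopping_congr (sturmian_add_convergentDen hβ hirr (m + 1) hk
      (by omega))) htr
  refine ⟨ψ, lt_of_mul_lt_mul_left (hle.trans_lt ?_)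
    (sub_nonneg.mpr (Nat.one_le_cast.mpr (by omega)))⟩
  have hlarge : 4 * C < (convergentDen β (m + 1) - 1) * c := by
    rw [← div_lt_iff₀ hc]
    have : (N : ℝ) + 2 ≤ convergentDen β (m + 1) := mod_cast hqN
    linarith
  rw [← mul_assoc]
  exact mul_lt_mul_of_pos_right hlarge (norm_pos_iff.mpr hψ)

theorem frequently_exists_abs_traceSeq_le_two (hβ : β ∈ Set.Icc (0 : ℝ) 1) (hirr : Irrational β)
    (h₁ : lam₁ ≠ 0) (h₂ : lam₂ ≠ 0)
    (hE : (E : ℂ) ∈ spectrum ℂ (offDiagonalOperator β lam₁ lam₂)) (N : ℕ) :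
    ∃ᶠ E' in 𝓝 E, ∃ n, N ≤ n ∧ |traceSeq β lam₁ lam₂ E' n| ≤ 2 := by
  refine Metric.nhds_basis_ball.frequently_iff.mpr fun c hc => ?_
  obtain ⟨u, s, hlt⟩ :=
    exists_truncation_norm_apply_sub_lt isSelfAdjoint_offDiagonalOperator hc hE
  obtain ⟨L, hL⟩ := exists_truncation_eq_zero_of_lt_abs u s
  obtain ⟨n, hn, hNn, hLn⟩ : ∃ n, Even n ∧ N ≤ n ∧ 2 * L + 2 < n :=
    ⟨2 * (N + L + 2), even_two_mul _, by omega, by omega⟩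
  have hq : n ≤ convergentDen β n := le_convergentDen hβ hirr n
  have hq' : convergentDen β n ≤ convergentDen β (n + 1) := convergentDen_le_succ hβ hirr n
  have : NeZero (convergentDen β n) := ⟨(convergentDen_pos hβ hirr n).ne'⟩
  obtain ⟨E', hE', htr⟩ := exists_trace_transferProduct_eq_two
    (hopping_ne_zero ⟨hβ.1, hβ.2.lt_of_ne hirr.ne_one⟩ h₁ h₂) (hopping_bounded β lam₁ lam₂)
    (fun k hk hk0 => hopping_congr
      (sturmian_add_convergentDen_of_even hβ hirr hn hk (by omega)))
    (hLn.trans_le hq) hL hlt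
  refine ⟨E', hE', n, hNn, ?_⟩
  rw [traceSeq, transferMatrix, htr, abs_two]

end Spectrum

end SturmianJacobi

end

open SturmianJacobi in
theorem theorem1_general {β : ℝ} (hβ : β ∈ Set.Icc (0 : ℝ) 1) (hirr : Irrational β)
    {lam₁ lam₂ : ℝ} (h₁ : lam₁ ≠ 0) (h₂ : lam₂ ≠ 0) :
    spectrum ℂ (offDiagonalOperator β lam₁ lam₂)
      = (fun E : ℝ => (E : ℂ)) '' pseudoSpectrum β lam₁ lam₂ := by
  ext z
  constructor
  · intro hz
    have hre : z = (z.re : ℂ) := isSelfAdjoint_offDiagonalOperator.mem_spectrum_eq_re hz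
    refine ⟨z.re, (mem_pseudoSpectrum_iff hβ hirr h₁ h₂).mpr fun hesc => ?_, hre.symm⟩
    rw [hre] at hz
    obtain ⟨N, hN⟩ := exists_eventually_two_lt_abs_traceSeq hβ hirr h₁ h₂ hesc
    obtain ⟨E, ⟨n, hn, htr⟩, hgt⟩ :=
      ((frequently_exists_abs_traceSeq_le_two hβ hirr h₁ h₂ hz N).and_eventually hN).exists
    exact (hgt n hn).not_ge htr
  · rintro ⟨E, hE, rfl⟩
    exact mem_spectrum_of_frequently_abs_traceSeq_le_two hβ hirr h₁ h₂
      (frequently_abs_traceSeq_le_two hβ hirr h₁ h₂ ((mem_pseudoSpectrum_iff hβ hirr h₁ h₂).mp hE))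

theorem theorem1 (β : ℝ) (hβ : β ∈ Set.Icc (0 : ℝ) 1) (hirr : Irrational β)
    (lam₁ lam₂ : ℝ) (h₁ : 0 < lam₁) (h₂ : 0 < lam₂) :
    spectrum ℂ (SturmianJacobi.offDiagonalOperator β lam₁ lam₂)
      = (fun E : ℝ => (E : ℂ)) '' SturmianJacobi.pseudoSpectrum β lam₁ lam₂ :=
  theorem1_general hβ hirr h₁.ne' h₂.ne'
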